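/- Consider the following dynamic matching market. Agents of type $H$ and of type $E$ arrive according to independent Poisson processes with rates $\lambda_H>0$ and $\lambda_E>0$. An agent of type $H$ (resp. $E$) finds the item of any other agent compatible with probability $p_H$ (resp. $p_E$), independently. An agent leaves the market when she receives a compatible item. - Under BilateralMatch(H), each arriving agent forms a 2-cycle (mutual compatibility) with a waiting agent if possible, cycles with $H$ agents having priority and further ties being broken uniformly at random; both agents then leave. Otherwise the arriving agent waits. - Under ChainMatch(d) there are always $d$ bridge agents who can give an item. If an arriving agent finds the item of at least one bridge agent compatible, she is matched by one of them and starts a chain-segment: the last agent of the segment gives her item to a waiting agent not yet in the segment who finds it compatible ($H$ agents first, ties broken uniformly at random), who becomes the last agent of the segment, and so on until no such agent exists. This is instantaneous; all agents of the segment leave the market, and the last one becomes a bridge agent in place of the one who started the segment. Otherwise the arriving agent waits. Under either policy the number of waiting agents of each type is a continuous-time Markov chain on $\mathbb{N}^2$. Let $w_H$ be the average waiting time of $H$ agents in steady-state, i.e. the expected waiting time of an $H$ agent who arrives when this chain is in its stationary distribution; write $w_H^{\mathcal{C}(d)}$ and $w_H^{\mathcal{B}_H}$ for its values under ChainMatch(d)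 and BilateralMatch(H). Let $0<\lambda_H<\lambda_E$, $p_E\in(0,1]$ and let $d\ge 1$ be an integer, all fixed. Then for every $p_H\in(0,1]$ the Markov chain of each of the two policies has exactly one stationary distribution, both of the limits below exist and are finite, and $$0<\lim_{p_H\to 0^+} p_H\, w_H^{\mathcal{C}(d)} < \lim_{p_H\to 0^+} p_H\, w_H^{\mathcal{B}_H}.$$ In particular, both average waiting times scale as $1/p_H$, and chains beat bilateral matching asymptotically by a constant factor. -/

import Mathlib

/-!
Little's law turns `p_H w_H` into `p_H E[h] / λ_H`, where `E[h]` is the mean number of waiting `H`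
agents, so it suffices to find the limit of `p_H E[h]`. Foster-Lyapunov functions give a stationary
law and all bounds on it.

Let `θ = -log (1 - p)`, where `p` is the probability `p_E p_H` of a 2-cycle of an `H` and an `E`
agent for BilateralMatch(H), and `p = p_H` for ChainMatch(d). The probability that some of the `h`
waiting `H` agents suits is then `1 - exp (-x)` with `x = θ h`, and as `p_H → 0` the number `x`
concentrates at the zero of its limiting drift.

* For BilateralMatch(H) the drift is `λ_H - λ_E (1 - exp (-x))`: `H` agents leave with arriving `E`
  agents, as cycles of two `H` agents have probability of order `p_H ^ 2` only. A quadratic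
  Lyapunov function gives the limit `-log (1 - λ_H / λ_E) / p_E` of `p_H E[h]`.
* For ChainMatch(d) a segment takes a geometric number of `H` agents, about `exp x - 1`, whenever it
  looks for one, and every waiting `E` agent it takes makes it look again. So all `E` agents, at
  once or after waiting, cause such a run, and the drift has the sign of `λ_H - λ_E (exp x - 1)`.
  The limit of `p_H E[h]` is `log (1 + λ_H / λ_E)`.

With `r = λ_H / λ_E`, chains win because `log (1 + r) < -log (1 - r) ≤ -log (1 - r) / p_E`.
-/

namespace DynMatch

/-- The two types of agents: hard-to-match (`H`) and easy-to-match (`E`). -/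
inductive Kind
  | H
  | E

/-- The state of the market: `(h, e)` is the number of waiting `H` agents and of waiting `E`
agents. -/
abbrev Market := ℕ × ℕ

/-- The point mass at the state `s`. -/
noncomputable def pt (s t : Market) : ℝ := if t = s then 1 else 0

/-- `find p n` is the probability that at least one of `n` independent trials with success
probability `p` succeeds. -/
noncomputable def find (p : ℝ) (n : ℕ) : ℝ := 1 - (1 - p) ^ n

/-- The probability that an agent of the given type finds a given item compatible. -/
def acceptProb (pH pE : ℝ) : Kind → ℝ
  | Kind.H => pH
  | Kind.E => pE

/-- The state after a newly arrived agent of the given type has joined the market. -/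
def join : Kind → Market → Market
  | Kind.H, s => (s.1 + 1, s.2)
  | Kind.E, s => (s.1, s.2 + 1)

/-- BilateralMatch(H): `bilateralMatchH pH pE k s t` is the probability that the arrival of an
agent of type `k` at state `s` leads to state `t`. A cycle with a given waiting agent of type `T`
exists with probability `p_k * p_T`. Cycles with `H` agents come first, then cycles with `E` agents;
without a cycle the new agent joins the market.
(For `s.1 = 0` or `s.2 = 0` the truncated subtraction comes with the factor `find _ 0 = 0`.) -/
noncomputable def bilateralMatchH (pH pE : ℝ) (k : Kind) (s t : Market) : ℝ :=
  let a := acceptProb pH pE k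
  find (a * pH) s.1 * pt (s.1 - 1, s.2) t
    + (1 - find (a * pH) s.1) * find (a * pE) s.2 * pt (s.1, s.2 - 1) t
    + (1 - find (a * pH) s.1) * (1 - find (a * pE) s.2) * pt (join k s) t

/-- Local search for a chain-segment: `segmentEnd pH pE h e t` is the probability that the market is
left in state `t`, when `h` and `e` agents are waiting outside the segment and the present last
agent of the segment has to give her item. If some waiting `H` agent finds the item compatible, one
such agent is appended; otherwise, if some waiting `E` agent finds it compatible, one such agent is
appended; otherwise the segment ends. The edges out of the present last agent have not been
examined before. -/
noncomputable def segmentEnd (pH pE : ℝ) : ℕ → ℕ → Market → ℝ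
  | 0, 0, t => pt (0, 0) t
  | 0, e + 1, t =>
      find pE (e + 1) * segmentEnd pH pE 0 e t
        + (1 - find pE (e + 1)) * pt (0, e + 1) t
  | h + 1, 0, t =>
      find pH (h + 1) * segmentEnd pH pE h 0 t
        + (1 - find pH (h + 1)) * pt (h + 1, 0) t
  | h + 1, e + 1, t =>
      find pH (h + 1) * segmentEnd pH pE h (e + 1) t
        + (1 - find pH (h + 1)) * find pE (e + 1) * segmentEnd pH pE (h + 1) e t
        + (1 - find pH (h + 1)) * (1 - find pE (e + 1)) * pt (h + 1, e + 1) t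
termination_by h e => h + e

/-- ChainMatch(d): `chainMatch d pH pE k s t` is the probability that the arrival of an agent of
type `k` at state `s` leads to state `t`. If she finds the item of one of the `d` bridge agents
compatible, she is matched and starts a chain-segment; otherwise she joins the market. -/
noncomputable def chainMatch (d : ℕ) (pH pE : ℝ) (k : Kind) (s t : Market) : ℝ :=
  find (acceptProb pH pE k) d * segmentEnd pH pE s.1 s.2 t
    + (1 - find (acceptProb pH pE k) d) * pt (join k s) t

/-- The transition rate matrix (diagonal included) of the continuous-time Markov chain of the
market: agents of type `H` and `E` arrive by independent Poisson processes of rates `lamH`, `lamE`,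
and an arrival of type `k` moves the market according to `P k`. -/
noncomputable def rateMatrix (lamH lamE : ℝ) (P : Kind → Market → Market → ℝ) (s t : Market) : ℝ :=
  lamH * (P Kind.H s t - pt s t) + lamE * (P Kind.E s t - pt s t)

/-- `π` is a steady-state distribution for the rate matrix `Q`: a probability distribution with
`π Q = 0`. -/
structure IsSteadyState (Q : Market → Market → ℝ) (π : Market → ℝ) : Prop where
  nonneg : ∀ s, 0 ≤ π s
  total : HasSum π 1
  balance : ∀ t, HasSum (fun s => π s * Q s t) 0

/-- The steady-state distribution for `Q` (meaningful when there is exactly one). -/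
noncomputable def steadyState (Q : Market → Market → ℝ) : Market → ℝ :=
  Classical.epsilon (IsSteadyState Q)

/-- `stay lamH lamE P n s` is the probability that a given `H` agent, waiting at state `s` (she is
one of the `s.1 ≥ 1` waiting `H` agents), is still waiting after the next `n` arrivals. An arrival
is of type `H` with probability `lamH / (lamH + lamE)`. An arrival that moves the market from `s`
to `t` either joins or removes `s.1 - t.1` of the `s.1` waiting `H` agents; ties within a type
being broken uniformly at random, a given one of them remains with probability
`min s.1 t.1 / s.1`. -/
noncomputable def stay (lamH lamE : ℝ) (P : Kind → Market → Market → ℝ) : ℕ → Market → ℝ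
  | 0, _ => 1
  | n + 1, s => ∑' t : Market,
      (lamH * P Kind.H s t + lamE * P Kind.E s t) / (lamH + lamE)
        * ((min s.1 t.1 : ℕ) / (s.1 : ℝ)) * stay lamH lamE P n t

/-- The expected remaining waiting time of a given `H` agent waiting at state `s`: she leaves at
an arrival epoch, and the times between consecutive arrivals have mean `1 / (lamH + lamE)` and are
independent of the types of the arrivals and of the transitions. -/
noncomputable def remainingWait (lamH lamE : ℝ) (P : Kind → Market → Market → ℝ) (s : Market) :
    ENNReal :=
  ∑' n : ℕ, ENNReal.ofReal (stay lamH lamE P n s / (lamH + lamE))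

/-- The average waiting time `w_H` in steady-state: the expected waiting time of an `H` agent who
arrives when the market is in steady-state. If she is matched at once, she does not wait; she joins
the market exactly when the number of waiting `H` agents goes up by one. -/
noncomputable def avgWaitH (lamH lamE : ℝ) (P : Kind → Market → Market → ℝ) : ENNReal :=
  ∑' s : Market, ENNReal.ofReal (steadyState (rateMatrix lamH lamE P) s) *
    ∑' t : Market,
      if t.1 = s.1 + 1 then ENNReal.ofReal (P Kind.H s t) * remainingWait lamH lamE P t else 0

end DynMatch

namespace DynMatch

open Filter Topology
open scoped ENNReal

/-! ### Markov chains whose rows have finite support -/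

section Markov

variable {S : Type*} {q r ρ f g u : S → ℝ} {P : S → S → ℝ} {a B : ℝ}

/-- A probability distribution with finite support, given by its weights. -/
structure IsFinDist (q : S → ℝ) : Prop where
  nonneg : ∀ t, 0 ≤ q t
  finite_support : q.support.Finite
  hasSum_one : HasSum q 1

/-- The mean of `f` under the weights `q` (with the junk value `0` if the series diverges). -/
noncomputable def mean (q f : S → ℝ) : ℝ := ∑' t, q t * f t

/-- The weights `ρ P` after one step of the chain `P` from the weights `ρ`. -/
noncomputable def push {R : Type*} [NonUnitalNonAssocSemiring R] [TopologicalSpace R]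
    (ρ : S → R) (P : S → S → R) (t : S) : R :=
  ∑' s, ρ s * P s t

/-- `P s t` are the transition probabilities of a Markov chain in which every state has finitely
many possible successors. -/
def IsStochastic (P : S → S → ℝ) : Prop := ∀ s, IsFinDist (P s)

/-- `π` is a stationary distribution of the Markov chain `P`. -/
structure IsStationary (P : S → S → ℝ) (π : S → ℝ) : Prop where
  nonneg : ∀ s, 0 ≤ π s
  hasSum_one : HasSum π 1
  push_eq : push π P = π

theorem mean_const_mul (q : S → ℝ) (c : ℝ) (f : S → ℝ) :
    mean q (fun t => c * f t) = c * mean q f := by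
  simp only [mean, ← tsum_mul_left, mul_left_comm]

namespace IsFinDist

theorem single [DecidableEq S] (s : S) : IsFinDist (Pi.single s 1 : S → ℝ) where
  nonneg t := by
    rw [Pi.single_apply]
    split_ifs <;> simp only [zero_le_one, le_rfl]
  finite_support := (Set.finite_singleton s).subset Pi.support_single_subset
  hasSum_one := hasSum_pi_single s 1

theorem le_one (hq : IsFinDist q) (t : S) : q t ≤ 1 :=
  le_hasSum hq.hasSum_one t fun s _ => hq.nonneg s

theorem hasSum_mean (hq : IsFinDist q) (f : S → ℝ) : HasSum (fun t => q t * f t) (mean q f) :=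
  (summable_of_hasFiniteSupport
    (hq.finite_support.subset (Function.support_mul_subset_left q f))).hasSum

theorem mean_mono (hq : IsFinDist q) (hfg : ∀ t, f t ≤ g t) : mean q f ≤ mean q g :=
  hasSum_le (fun t => mul_le_mul_of_nonneg_left (hfg t) (hq.nonneg t))
    (hq.hasSum_mean f) (hq.hasSum_mean g)

theorem mean_const (hq : IsFinDist q) (c : ℝ) : mean q (fun _ => c) = c := by
  simpa only [mean, one_mul] using (hq.hasSum_one.mul_right c).tsum_eq

theorem mean_nonneg (hq : IsFinDist q) (hf : ∀ t, 0 ≤ f t) : 0 ≤ mean q f :=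
  tsum_nonneg fun t => mul_nonneg (hq.nonneg t) (hf t)

theorem mean_add (hq : IsFinDist q) (f g : S → ℝ) :
    mean q (fun t => f t + g t) = mean q f + mean q g := by
  simpa only [mean, mul_add] using ((hq.hasSum_mean f).add (hq.hasSum_mean g)).tsum_eq

theorem mix (hq : IsFinDist q) (hr : IsFinDist r) (ha₀ : 0 ≤ a) (ha₁ : a ≤ 1) :
    IsFinDist fun t => a * q t + (1 - a) * r t where
  nonneg t := add_nonneg (mul_nonneg ha₀ (hq.nonneg t))
    (mul_nonneg (sub_nonneg.2 ha₁) (hr.nonneg t))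
  finite_support := (hq.finite_support.union hr.finite_support).subset fun t ht => by
    by_contra hqr
    simp only [Set.mem_union, Function.mem_support, not_or, not_not] at hqr
    simp [hqr] at ht
  hasSum_one := by
    simpa using (hq.hasSum_one.mul_left a).add (hr.hasSum_one.mul_left (1 - a))

theorem mean_mix (hq : IsFinDist q) (hr : IsFinDist r) (a : ℝ) (f : S → ℝ) :
    mean (fun t => a * q t + (1 - a) * r t) f = a * mean q f + (1 - a) * mean r f := by
  simpa only [mean, add_mul, mul_assoc] using
    (((hq.hasSum_mean f).mul_left a).add ((hr.hasSum_mean f).mul_left (1 - a))).tsum_eq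

end IsFinDist

theorem mean_push (h : Summable fun p : S × S => ρ p.1 * P p.1 p.2 * u p.2) :
    mean (push ρ P) u = mean ρ fun s => mean (P s) u := by
  simp only [mean, push, ← tsum_mul_right, ← tsum_mul_left, ← mul_assoc]
  exact Summable.tsum_comm (f := fun s t => ρ s * P s t * u t) h

namespace IsStochastic

theorem summable_flow (hP : IsStochastic P) (hρ : Summable ρ) :
    Summable fun p : S × S => ρ p.1 * P p.1 p.2 := by
  have row : ∀ s, HasSum (fun t => ‖ρ s * P s t‖) ‖ρ s‖ := fun s => by
    simpa only [norm_mul, Real.norm_of_nonneg ((hP s).nonneg _), mul_one]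
      using (hP s).hasSum_one.mul_left ‖ρ s‖
  refine Summable.of_norm ((summable_prod_of_nonneg fun p => norm_nonneg _).2
    ⟨fun s => (row s).summable, ?_⟩)
  simpa only [(row _).tsum_eq] using hρ.norm

theorem hasSum_push_apply (hP : IsStochastic P) (hρ : Summable ρ) (t : S) :
    HasSum (fun s => ρ s * P s t) (push ρ P t) :=
  ((hP.summable_flow hρ).prod_symm.prod_factor t).hasSum

theorem summable_flow_mul (hP : IsStochastic P) (hρ : Summable ρ) (hu : ∀ s, |u s| ≤ B) :
    Summable fun p : S × S => ρ p.1 * P p.1 p.2 * u p.2 :=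
  Summable.of_norm_bounded ((hP.summable_flow hρ).norm.mul_right B) fun p => by
    rw [norm_mul]
    exact mul_le_mul_of_nonneg_left (hu p.2) (norm_nonneg _)

theorem hasSum_push (hP : IsStochastic P) (hρ : Summable ρ) : HasSum (push ρ P) (∑' s, ρ s) := by
  have flow := hP.summable_flow hρ
  have total : mean (push ρ P) (fun _ => 1) = mean ρ fun _ => 1 := by
    rw [mean_push (by simpa only [mul_one] using flow)]
    simp only [(hP _).mean_const]
  simp only [mean, mul_one] at total
  exact total ▸ flow.prod_symm.prod.hasSum

theorem push_neg (P : S → S → ℝ) (ρ : S → ℝ) : push (-ρ) P = -push ρ P := by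
  funext t
  simp only [push, Pi.neg_apply, neg_mul, tsum_neg]

theorem push_eq_of_push_le (hP : IsStochastic P) (hρ : Summable ρ) (h : ∀ t, push ρ P t ≤ ρ t) :
    push ρ P = ρ := by
  have deficit : HasSum (fun t => ρ t - push ρ P t) 0 := by
    simpa only [sub_self] using hρ.hasSum.sub (hP.hasSum_push hρ)
  funext t
  exact (sub_eq_zero.1
    (congrFun ((hasSum_zero_iff_of_nonneg fun t => sub_nonneg.2 (h t)).1 deficit) t)).symm

theorem push_eq_of_le_push (hP : IsStochastic P) (hρ : Summable ρ) (h : ∀ t, ρ t ≤ push ρ P t) :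
    push ρ P = ρ := by
  have := hP.push_eq_of_push_le hρ.neg (ρ := -ρ) fun t => by
    rw [push_neg]
    exact neg_le_neg (h t)
  rwa [push_neg, neg_inj] at this

theorem isFinDist_push (hP : IsStochastic P) (hq : IsFinDist q) : IsFinDist (push q P) where
  nonneg t := tsum_nonneg fun s => mul_nonneg (hq.nonneg s) ((hP s).nonneg t)
  finite_support := by
    refine (hq.finite_support.biUnion fun s _ => (hP s).finite_support).subset fun t ht => ?_
    obtain ⟨s, hs⟩ : ∃ s, q s * P s t ≠ 0 := by
      by_contra! h
      exact ht (by simp only [push, h, tsum_zero])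
    exact Set.mem_biUnion (left_ne_zero_of_mul hs) (right_ne_zero_of_mul hs)
  hasSum_one := hq.hasSum_one.tsum_eq ▸ hP.hasSum_push hq.hasSum_one.summable

theorem mean_push_of_isFinDist (hP : IsStochastic P) (hq : IsFinDist q) (f : S → ℝ) :
    mean (push q P) f = mean q fun s => mean (P s) f := by
  refine mean_push (summable_of_hasFiniteSupport ?_)
  refine (hq.finite_support.biUnion fun s _ =>
    (Set.finite_singleton s).prod (hP s).finite_support).subset fun p hp => ?_
  have hflow := left_ne_zero_of_mul hp
  exact Set.mem_biUnion (left_ne_zero_of_mul hflow) ⟨rfl, right_ne_zero_of_mul hflow⟩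

end IsStochastic

theorem IsFinDist.mean_min_le (hq : IsFinDist q) (f : S → ℝ) (M : ℝ) :
    mean q (fun t => min (f t) M) ≤ min (mean q f) M :=
  le_min (hq.mean_mono fun _ => min_le_left _ _)
    ((hq.mean_mono fun _ => min_le_right _ _).trans (hq.mean_const M).le)

namespace IsStationary

variable {π π₁ π₂ : S → ℝ}

theorem hasSum_mean (hπ : IsStationary P π) (hu : ∀ s, |u s| ≤ B) :
    HasSum (fun s => π s * u s) (mean π u) :=
  (Summable.of_norm_bounded (hπ.hasSum_one.summable.mul_right B) fun s => by
    rw [norm_mul, Real.norm_of_nonneg (hπ.nonneg s)]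
    exact mul_le_mul_of_nonneg_left (hu s) (hπ.nonneg s)).hasSum

theorem hasSum_mean_step (hP : IsStochastic P) (hπ : IsStationary P π) (hu : ∀ s, |u s| ≤ B) :
    HasSum (fun s => π s * mean (P s) u) (mean π u) := by
  have flow := hP.summable_flow_mul hπ.hasSum_one.summable hu
  have total : mean π u = mean π fun s => mean (P s) u := by
    rw [← mean_push flow, hπ.push_eq]
  rw [total]
  refine Summable.hasSum (flow.prod.congr fun s => ?_)
  simp only [mean, ← tsum_mul_left, mul_assoc]

theorem truncated_drift (hP : IsStochastic P) {C M : ℝ} (hC : 0 ≤ C)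
    (drift : ∀ s, mean (P s) f ≤ f s - g s + C) (s : S) :
    mean (P s) (fun t => min (f t) M) ≤ min (f s) M - (if f s ≤ M then g s else 0) + C := by
  have step := (hP s).mean_min_le f M
  split_ifs with hs
  · rw [min_eq_left hs]
    exact step.trans ((min_le_left _ _).trans (drift s))
  · rw [min_eq_right (not_le.1 hs).le]
    linarith [step.trans (min_le_right _ _)]

theorem sum_le_of_drift (hP : IsStochastic P) (hπ : IsStationary P π) {m C : ℝ}
    (hf : ∀ s, m ≤ f s) (hg : ∀ s, 0 ≤ g s) (hC : 0 ≤ C)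
    (drift : ∀ s, mean (P s) f ≤ f s - g s + C) (F : Finset S) :
    ∑ s ∈ F, π s * g s ≤ C := by
  classical
  -- `f` may fail to be integrable under `π`: the drift is summed for the truncation `min f M`.
  set M := ∑ s ∈ F, |f s|
  have hM : 0 ≤ M := Finset.sum_nonneg fun t _ => abs_nonneg (f t)
  have le_M : ∀ s ∈ F, f s ≤ M := fun s hs =>
    (le_abs_self _).trans (Finset.single_le_sum (fun t _ => abs_nonneg (f t)) hs)
  have bounded : ∀ s, |min (f s) M| ≤ |m| + M := fun s => abs_le.2
    ⟨le_min (by linarith [hf s, neg_abs_le m]) (by linarith [abs_nonneg m]),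
      (min_le_right _ _).trans (by linarith [abs_nonneg m])⟩
  have gain : HasSum (fun s => if s ∈ F then π s * g s else 0) (∑ s ∈ F, π s * g s) := by
    rw [← Finset.sum_congr rfl fun s hs => if_pos hs]
    exact hasSum_sum_of_ne_finset_zero fun s hs => if_neg hs
  have pointwise : ∀ s, π s * mean (P s) (fun t => min (f t) M)
      ≤ π s * min (f s) M - (if s ∈ F then π s * g s else 0) + π s * C := fun s => by
    have step : mean (P s) (fun t => min (f t) M)
        ≤ min (f s) M - (if s ∈ F then g s else 0) + C := by
      refine (truncated_drift hP hC drift s).trans ?_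
      gcongr
      split_ifs with hs hM hM
      exacts [le_rfl, absurd (le_M s hs) hM, hg s, le_rfl]
    have := mul_le_mul_of_nonneg_left step (hπ.nonneg s)
    split_ifs at this ⊢ <;> linarith
  have := hasSum_le pointwise (hπ.hasSum_mean_step hP bounded)
    (((hπ.hasSum_mean bounded).sub gain).add (hπ.hasSum_one.mul_right C))
  linarith

theorem mean_le_of_drift (hP : IsStochastic P) (hπ : IsStationary P π) {m C : ℝ}
    (hf : ∀ s, m ≤ f s) (hg : ∀ s, 0 ≤ g s) (hC : 0 ≤ C)
    (drift : ∀ s, mean (P s) f ≤ f s - g s + C) :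
    Summable (fun s => π s * g s) ∧ mean π g ≤ C := by
  have partial_sums := hπ.sum_le_of_drift hP hf hg hC drift
  have nonneg : ∀ s, 0 ≤ π s * g s := fun s => mul_nonneg (hπ.nonneg s) (hg s)
  exact ⟨summable_of_sum_le nonneg partial_sums, Real.tsum_le_of_sum_le nonneg partial_sums⟩

end IsStationary

namespace IsStochastic

theorem pos_of_reachable (hP : IsStochastic P) (hρ₀ : ∀ s, 0 ≤ ρ s) (hρ : Summable ρ)
    (invariant : push ρ P = ρ) {s o : S} (hs : 0 < ρ s)
    (reach : Relation.ReflTransGen (fun s t => 0 < P s t) s o) : 0 < ρ o := by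
  induction reach with
  | refl => exact hs
  | @tail b c _ hbc ih =>
    calc 0 < ρ b * P b c := mul_pos ih hbc
      _ ≤ push ρ P c := le_hasSum (hP.hasSum_push_apply hρ c) b fun s _ =>
          mul_nonneg (hρ₀ s) ((hP s).nonneg c)
      _ = ρ c := congrFun invariant c

theorem push_abs_eq (hP : IsStochastic P) (hρ : Summable ρ) (invariant : push ρ P = ρ) :
    push (fun s => |ρ s|) P = fun s => |ρ s| := by
  refine hP.push_eq_of_le_push hρ.abs fun t => ?_
  have flow := hP.hasSum_push_apply hρ.abs t
  have abs_flow : ∀ s, |ρ s| * P s t = ‖ρ s * P s t‖ := fun s => by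
    rw [norm_mul, Real.norm_eq_abs, Real.norm_of_nonneg ((hP s).nonneg t)]
  calc |ρ t| = ‖∑' s, ρ s * P s t‖ := by rw [Real.norm_eq_abs, ← congrFun invariant t, push]
    _ ≤ ∑' s, ‖ρ s * P s t‖ := norm_tsum_le_tsum_norm (flow.summable.congr fun s => abs_flow s)
    _ = push (fun s => |ρ s|) P t := by simp only [push, abs_flow]

theorem nonpos_of_invariant (hP : IsStochastic P) (hρ : Summable ρ) (invariant : push ρ P = ρ)
    {o : S} (reach : ∀ s, Relation.ReflTransGen (fun s t => 0 < P s t) s o) (ho : ρ o ≤ 0)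
    (s : S) : ρ s ≤ 0 := by
  have positive_part : push (fun s => |ρ s| + ρ s) P = fun s => |ρ s| + ρ s := by
    funext t
    have := (hP.hasSum_push_apply hρ.abs t).add (hP.hasSum_push_apply hρ t)
    simp only [← add_mul, hP.push_abs_eq hρ invariant, invariant] at this
    exact this.tsum_eq
  by_contra! hs
  have := hP.pos_of_reachable (fun s => by linarith [neg_abs_le (ρ s)]) (hρ.abs.add hρ)
    positive_part (by linarith [abs_nonneg (ρ s)]) (reach s)
  rw [abs_of_nonpos ho] at this
  linarith

theorem eq_zero_of_invariant (hP : IsStochastic P) (hρ : HasSum ρ 0) (invariant : push ρ P = ρ)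
    {o : S} (reach : ∀ s, Relation.ReflTransGen (fun s t => 0 < P s t) s o) : ρ = 0 := by
  rcases le_total (ρ o) 0 with ho | ho
  · have nonpos := hP.nonpos_of_invariant hρ.summable invariant reach ho
    have neg_eq : -ρ = 0 :=
      (hasSum_zero_iff_of_nonneg fun s => neg_nonneg.2 (nonpos s)).1 (by simpa using hρ.neg)
    exact neg_eq_zero.1 neg_eq
  · have neg_invariant : push (-ρ) P = -ρ := by rw [push_neg, invariant]
    have nonpos := hP.nonpos_of_invariant hρ.summable.neg neg_invariant reach (neg_nonpos.2 ho)
    exact (hasSum_zero_iff_of_nonneg fun s => neg_nonpos.1 (nonpos s)).1 hρ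

end IsStochastic

theorem IsStationary.unique (hP : IsStochastic P) {o : S}
    (reach : ∀ s, Relation.ReflTransGen (fun s t => 0 < P s t) s o) {π₁ π₂ : S → ℝ}
    (h₁ : IsStationary P π₁) (h₂ : IsStationary P π₂) : π₁ = π₂ := by
  have sum_zero : HasSum (π₁ - π₂) 0 := by
    have := h₁.hasSum_one.sub h₂.hasSum_one
    rwa [sub_self] at this
  refine sub_eq_zero.1 (hP.eq_zero_of_invariant sum_zero ?_ reach)
  funext t
  have := (hP.hasSum_push_apply h₁.hasSum_one.summable t).sub
    (hP.hasSum_push_apply h₂.hasSum_one.summable t)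
  simp only [← sub_mul, h₁.push_eq, h₂.push_eq] at this
  exact this.tsum_eq

/-- The average of the laws of the chain `P` at the times `0, …, n`, when it starts with the law
`q`; a limit point of these averages is the stationary distribution to be constructed. -/
noncomputable def cesaro (P : S → S → ℝ) (q : S → ℝ) (n : ℕ) (t : S) : ℝ :=
  ((n : ℝ) + 1)⁻¹ * ∑ k ∈ Finset.range (n + 1), (push · P)^[k] q t

theorem mean_single [DecidableEq S] (q : S → ℝ) (t : S) : mean q (Pi.single t 1) = q t := by
  rw [mean, tsum_eq_single t fun s hs => by rw [Pi.single_eq_of_ne hs, mul_zero],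
    Pi.single_eq_same, mul_one]

namespace IsStochastic

theorem isFinDist_iterate (hP : IsStochastic P) (hq : IsFinDist q) (n : ℕ) :
    IsFinDist ((push · P)^[n] q) := by
  induction n with
  | zero => exact hq
  | succ n ih => rw [Function.iterate_succ_apply']; exact hP.isFinDist_push ih

theorem isFinDist_cesaro (hP : IsStochastic P) (hq : IsFinDist q) (n : ℕ) :
    IsFinDist (cesaro P q n) where
  nonneg t := mul_nonneg (by positivity)
    (Finset.sum_nonneg fun k _ => (hP.isFinDist_iterate hq k).nonneg t)
  finite_support := by
    refine ((Finset.range (n + 1)).finite_toSet.biUnion fun k _ =>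
      (hP.isFinDist_iterate hq k).finite_support).subset fun t ht => ?_
    obtain ⟨k, hk, hkt⟩ := Finset.exists_ne_zero_of_sum_ne_zero (right_ne_zero_of_mul ht)
    exact Set.mem_biUnion hk hkt
  hasSum_one := by
    have := (hasSum_sum fun k (_ : k ∈ Finset.range (n + 1)) =>
      (hP.isFinDist_iterate hq k).hasSum_one).mul_left ((n : ℝ) + 1)⁻¹
    rw [Finset.sum_const, Finset.card_range, nsmul_one, Nat.cast_add_one,
      inv_mul_cancel₀ (by positivity)] at this
    exact this

theorem mean_cesaro (hP : IsStochastic P) (hq : IsFinDist q) (n : ℕ) (f : S → ℝ) :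
    mean (cesaro P q n) f
      = ((n : ℝ) + 1)⁻¹ * ∑ k ∈ Finset.range (n + 1), mean ((push · P)^[k] q) f := by
  rw [← ((hasSum_sum fun k (_ : k ∈ Finset.range (n + 1)) =>
    (hP.isFinDist_iterate hq k).hasSum_mean f).mul_left ((n : ℝ) + 1)⁻¹).tsum_eq]
  simp only [mean, cesaro, Finset.sum_mul, mul_assoc]

theorem mean_push_cesaro (hP : IsStochastic P) (hq : IsFinDist q) (n : ℕ) (f : S → ℝ) :
    mean (push (cesaro P q n) P) f = mean (cesaro P q n) f
      + ((n : ℝ) + 1)⁻¹ * (mean ((push · P)^[n + 1] q) f - mean q f) := by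
  have shift : ∀ k, (mean ((push · P)^[k] q) fun s => mean (P s) f)
      = mean ((push · P)^[k + 1] q) f := fun k => by
    rw [Function.iterate_succ_apply',
      hP.mean_push_of_isFinDist (hP.isFinDist_iterate hq k)]
  have telescope := Finset.sum_range_succ' (fun k => mean ((push · P)^[k] q) f) (n + 1)
  rw [Finset.sum_range_succ, Function.iterate_zero_apply] at telescope
  rw [hP.mean_push_of_isFinDist (hP.isFinDist_cesaro hq n), hP.mean_cesaro hq, hP.mean_cesaro hq,
    Finset.sum_congr rfl fun k _ => shift k, ← mul_add]
  congr 1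
  linarith

theorem push_cesaro_le (hP : IsStochastic P) (hq : IsFinDist q) (n : ℕ) (t : S) :
    push (cesaro P q n) P t ≤ cesaro P q n t + 1 / ((n : ℝ) + 1) := by
  classical
  rw [← mean_single (push (cesaro P q n) P) t, hP.mean_push_cesaro hq, mean_single, mean_single,
    mean_single, one_div]
  gcongr
  exact mul_le_of_le_one_right (by positivity)
    (by linarith [(hP.isFinDist_iterate hq (n + 1)).le_one t, hq.nonneg t])

theorem mean_cesaro_le_of_drift (hP : IsStochastic P) (hq : IsFinDist q) {C : ℝ}
    (hf : ∀ s, 0 ≤ f s) (drift : ∀ s, mean (P s) f ≤ f s - g s + C) (n : ℕ) :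
    mean (cesaro P q n) g ≤ C + mean q f := by
  have hc := hP.isFinDist_cesaro hq n
  have averaged := hc.mean_mono fun s => (by linarith [drift s] : mean (P s) f + g s ≤ f s + C)
  rw [hc.mean_add, hc.mean_add, hc.mean_const, ← hP.mean_push_of_isFinDist hc,
    hP.mean_push_cesaro hq] at averaged
  have start : ((n : ℝ) + 1)⁻¹ * mean q f ≤ mean q f :=
    mul_le_of_le_one_left (hq.mean_nonneg hf) (inv_le_one_of_one_le₀ (by simp))
  have last : 0 ≤ ((n : ℝ) + 1)⁻¹ * mean ((push · P)^[n + 1] q) f :=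
    mul_nonneg (by positivity) ((hP.isFinDist_iterate hq (n + 1)).mean_nonneg hf)
  linarith

end IsStochastic

theorem IsFinDist.one_sub_div_le_sum (hq : IsFinDist q) (hg : ∀ s, 0 ≤ g s) (hB : mean q g ≤ B)
    {M : ℝ} (hM : 0 < M) {F : Finset S} (hF : ∀ s, g s ≤ M → s ∈ F) :
    1 - B / M ≤ ∑ s ∈ F, q s := by
  classical
  have restricted : HasSum (fun s => if s ∈ F then q s else 0) (∑ s ∈ F, q s) := by
    rw [← Finset.sum_congr rfl fun s hs => if_pos hs]
    exact hasSum_sum_of_ne_finset_zero fun s hs => if_neg hs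
  have pointwise : ∀ s, q s ≤ (if s ∈ F then q s else 0) + q s * g s / M := fun s => by
    split_ifs with hs
    · exact le_add_of_nonneg_right (div_nonneg (mul_nonneg (hq.nonneg s) (hg s)) hM.le)
    · rw [zero_add, le_div_iff₀ hM]
      exact mul_le_mul_of_nonneg_left (not_le.1 (mt (hF s) hs)).le (hq.nonneg s)
  have := hasSum_le pointwise hq.hasSum_one (restricted.add ((hq.hasSum_mean g).div_const M))
  have := div_le_div_of_nonneg_right hB hM.le
  linarith

theorem exists_tendsto_of_tight {ι : Type*} (U : Ultrafilter ι) {x : ι → S → ℝ}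
    (hx : ∀ i, IsFinDist (x i)) (hg : ∀ s, 0 ≤ g s) (hfin : ∀ M : ℝ, {s | g s ≤ M}.Finite)
    (hB : ∀ i, mean (x i) g ≤ B) :
    ∃ π : S → ℝ, (∀ s, 0 ≤ π s) ∧ HasSum π 1 ∧ ∀ s, Tendsto (fun i => x i s) U (𝓝 (π s)) := by
  obtain ⟨π, -, hπ⟩ : ∃ π ∈ Set.pi Set.univ (fun _ : S => Set.Icc (0 : ℝ) 1),
      (U.map x : Filter (S → ℝ)) ≤ 𝓝 π :=
    (isCompact_univ_pi fun _ => isCompact_Icc).ultrafilter_le_nhds (U.map x)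
      (le_principal_iff.2 (Ultrafilter.mem_map.2
        (univ_mem' fun i s _ => ⟨(hx i).nonneg s, (hx i).le_one s⟩)))
  have lim : ∀ s, Tendsto (fun i => x i s) U (𝓝 (π s)) := tendsto_pi_nhds.1 hπ
  have nonneg : ∀ s, 0 ≤ π s := fun s => ge_of_tendsto' (lim s) fun i => (hx i).nonneg s
  have sum_le : ∀ F : Finset S, ∑ s ∈ F, π s ≤ 1 := fun F =>
    le_of_tendsto' (tendsto_finsetSum F fun s _ => lim s) fun i =>
      sum_le_hasSum F (fun s _ => (hx i).nonneg s) (hx i).hasSum_one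
  have summable : Summable π := summable_of_sum_le nonneg sum_le
  have mass_ge : ∀ n : ℕ, 1 - B / ((n : ℝ) + 1) ≤ ∑' s, π s := fun n => by
    refine le_trans ?_ (summable.sum_le_tsum (hfin (n + 1)).toFinset fun s _ => nonneg s)
    exact ge_of_tendsto' (tendsto_finsetSum _ fun s _ => lim s) fun i =>
      (hx i).one_sub_div_le_sum hg (hB i) (by positivity) fun s hs =>
        (hfin (n + 1)).mem_toFinset.2 hs
  have mass_lim : Tendsto (fun n : ℕ => 1 - B / ((n : ℝ) + 1)) atTop (𝓝 1) := by
    simpa [div_eq_mul_inv] using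
      (tendsto_one_div_add_atTop_nhds_zero_nat (𝕜 := ℝ)).const_mul B |>.const_sub 1
  have mass : ∑' s, π s = 1 :=
    le_antisymm (Real.tsum_le_of_sum_le nonneg sum_le) (le_of_tendsto' mass_lim mass_ge)
  exact ⟨π, nonneg, mass ▸ summable.hasSum, lim⟩

theorem exists_isStationary_of_drift (hP : IsStochastic P) (o : S) {C : ℝ} (hf : ∀ s, 0 ≤ f s)
    (hg : ∀ s, 0 ≤ g s) (drift : ∀ s, mean (P s) f ≤ f s - g s + C)
    (hfin : ∀ M : ℝ, {s | g s ≤ M}.Finite) : ∃ π, IsStationary P π := by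
  classical
  have hq := IsFinDist.single o
  obtain ⟨π, nonneg, hasSum_one, lim⟩ := exists_tendsto_of_tight (hyperfilter ℕ)
    (hP.isFinDist_cesaro hq) hg hfin (hP.mean_cesaro_le_of_drift hq hf drift)
  refine ⟨π, nonneg, hasSum_one, hP.push_eq_of_push_le hasSum_one.summable fun t => ?_⟩
  refine Real.tsum_le_of_sum_le (fun s => mul_nonneg (nonneg s) ((hP s).nonneg t)) fun F => ?_
  have error : Tendsto (fun n : ℕ => cesaro P (Pi.single o 1) n t + 1 / ((n : ℝ) + 1))
      (hyperfilter ℕ) (𝓝 (π t + 0)) :=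
    (lim t).add (tendsto_one_div_add_atTop_nhds_zero_nat.mono_left Nat.hyperfilter_le_atTop)
  rw [add_zero] at error
  refine le_of_tendsto_of_tendsto' (tendsto_finsetSum F fun s _ => (lim s).mul_const _) error
    fun n => le_trans ?_ (hP.push_cesaro_le hq n t)
  have hc := hP.isFinDist_cesaro hq n
  exact sum_le_hasSum F (fun s _ => mul_nonneg (hc.nonneg s) ((hP s).nonneg t))
    (hP.hasSum_push_apply hc.hasSum_one.summable t)

end Markov

/-! ### Little's law -/

section Little

theorem sum_range_add_of_telescope {M : Type*} [AddCommMonoid M] {x c : ℕ → M}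
    (h : ∀ n, x n + c (n + 1) = c n) (N : ℕ) : ∑ n ∈ Finset.range N, x n + c N = c 0 := by
  induction N with
  | zero => rw [Finset.sum_range_zero, zero_add]
  | succ N ih => rw [Finset.sum_range_succ, add_assoc, h, ih]

variable {S : Type*} {K : S → S → ℝ≥0∞} {ν m ρ : S → ℝ≥0∞}

/-- The probability that a particle that starts at a given state and moves according to the
substochastic kernel `K` survives `n` steps. -/
noncomputable def survival (K : S → S → ℝ≥0∞) : ℕ → S → ℝ≥0∞
  | 0, _ => 1
  | n + 1, s => ∑' t, K s t * survival K n t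

theorem tsum_push_mul (ν : S → ℝ≥0∞) (K : S → S → ℝ≥0∞) (w : S → ℝ≥0∞) :
    ∑' t, push ν K t * w t = ∑' s, ν s * ∑' t, K s t * w t := by
  simp only [push, ← ENNReal.tsum_mul_left, ← ENNReal.tsum_mul_right, ← mul_assoc]
  exact ENNReal.tsum_comm

theorem tsum_mul_survival (K : S → S → ℝ≥0∞) (n : ℕ) (ν : S → ℝ≥0∞) :
    ∑' s, ν s * survival K n s = ∑' s, (push · K)^[n] ν s := by
  induction n generalizing ν with
  | zero => simp only [survival, mul_one, Function.iterate_zero_apply]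
  | succ n ih =>
    rw [Function.iterate_succ_apply, ← ih, tsum_push_mul]
    rfl

theorem tsum_push_add_loss (hK : ∀ s, ∑' t, K s t ≤ 1) (ρ : S → ℝ≥0∞) :
    ∑' s, ρ s * (1 - ∑' t, K s t) + ∑' t, push ρ K t = ∑' s, ρ s := by
  have pushed : ∑' t, push ρ K t = ∑' s, ρ s * ∑' t, K s t := by
    simpa only [mul_one] using tsum_push_mul ρ K fun _ => 1
  rw [pushed, ← ENNReal.tsum_add]
  exact tsum_congr fun s => by rw [← mul_add, tsub_add_cancel_of_le (hK s), mul_one]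

theorem iterate_push_le (flow : ∀ t, push ν K t + m t = ν t) (n : ℕ) (t : S) :
    (push · K)^[n] ν t ≤ ν t := by
  induction n generalizing t with
  | zero => exact le_rfl
  | succ n ih =>
    rw [Function.iterate_succ_apply', ← flow t]
    exact (ENNReal.tsum_le_tsum fun s => mul_le_mul_left (ih s) _).trans le_self_add

theorem tendsto_iterate_push (hK : ∀ s, ∑' t, K s t < 1) (hν : ∑' s, ν s ≠ ∞) (s : S) :
    Tendsto (fun n => (push · K)^[n] ν s) atTop (𝓝 0) := by
  set loss := 1 - ∑' t, K s t
  have loss_ne_zero : loss ≠ 0 := (tsub_pos_of_lt (hK s)).ne'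
  have loss_ne_top : loss ≠ ∞ := ne_top_of_le_ne_top ENNReal.one_ne_top tsub_le_self
  have telescope := sum_range_add_of_telescope
    (c := fun n => ∑' s, (push · K)^[n] ν s) fun n => by
      rw [Function.iterate_succ_apply']
      exact tsum_push_add_loss (fun s => (hK s).le) _
  have total_loss : ∑' n, (push · K)^[n] ν s * loss ≠ ∞ := by
    refine ne_top_of_le_ne_top hν (ENNReal.tsum_le_of_sum_range_le fun N => ?_)
    refine le_trans ?_ (le_self_add.trans (telescope N).le)
    exact Finset.sum_le_sum fun n _ => ENNReal.le_tsum s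
  have lim := ENNReal.Tendsto.mul_const (b := loss⁻¹)
    (ENNReal.tendsto_atTop_zero_of_tsum_ne_top total_loss)
    (Or.inr (ENNReal.inv_ne_top.2 loss_ne_zero))
  simpa only [mul_assoc, ENNReal.mul_inv_cancel loss_ne_zero loss_ne_top, mul_one, zero_mul]
    using lim

theorem tendsto_tsum_iterate_push (hK : ∀ s, ∑' t, K s t < 1) (hν : ∑' s, ν s ≠ ∞)
    (flow : ∀ t, push ν K t + m t = ν t) :
    Tendsto (fun n => ∑' s, (push · K)^[n] ν s) atTop (𝓝 0) := by
  let _ : MeasurableSpace S := ⊤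
  have lim := MeasureTheory.tendsto_lintegral_of_dominated_convergence
    (μ := MeasureTheory.Measure.count) (F := fun n => (push · K)^[n] ν) (f := fun _ => 0) ν
    (fun n => measurable_from_top) (fun n => .of_forall (iterate_push_le flow n))
    (by rwa [MeasureTheory.lintegral_count])
    (.of_forall (tendsto_iterate_push hK hν))
  simpa only [MeasureTheory.lintegral_count, tsum_zero] using lim

/-- Little's law: `m` is the inflow and `ν` the population in equilibrium. -/
theorem tsum_tsum_mul_survival (hK : ∀ s, ∑' t, K s t < 1) (hν : ∑' s, ν s ≠ ∞)
    (flow : ∀ t, push ν K t + m t = ν t) :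
    ∑' n, ∑' t, m t * survival K n t = ∑' s, ν s := by
  have telescope := sum_range_add_of_telescope (x := fun n => ∑' t, m t * survival K n t)
    (c := fun n => ∑' s, (push · K)^[n] ν s) fun n => by
      rw [Function.iterate_succ_apply, ← tsum_mul_survival, ← tsum_mul_survival,
        ← ENNReal.tsum_add]
      exact tsum_congr fun t => by rw [← add_mul, add_comm (m t), flow]
  have lim := (ENNReal.tendsto_nat_tsum fun n => ∑' t, m t * survival K n t).add
    (tendsto_tsum_iterate_push hK hν flow)
  rw [add_zero] at lim
  exact tendsto_nhds_unique lim (tendsto_const_nhds.congr fun N => (telescope N).symm)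

end Little

/-! ### The jump chain of the market -/

section Policy

variable {P : Kind → Market → Market → ℝ} {lamH lamE : ℝ} {π : Market → ℝ}

/-- The transition probabilities of the market at arrival epochs. -/
noncomputable def jumpProb (lamH lamE : ℝ) (P : Kind → Market → Market → ℝ) (s t : Market) : ℝ :=
  (lamH * P Kind.H s t + lamE * P Kind.E s t) / (lamH + lamE)

/-- The probability that a given one of the `H` agents waiting at `s` is not removed by the next
arrival and that this arrival moves the market to `t`; the junk value `x / 0 = 0` makes it `0` if no
`H` agent waits at `s`. -/
noncomputable def stayProb (lamH lamE : ℝ) (P : Kind → Market → Market → ℝ) (s t : Market) : ℝ :=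
  jumpProb lamH lamE P s t * ((min s.1 t.1 : ℕ) / (s.1 : ℝ))

/-- The probability that the next arrival is an `H` agent who joins the market and that this arrival
moves the market from `s` to `t`. -/
noncomputable def joinProb (lamH lamE : ℝ) (P : Kind → Market → Market → ℝ) (s t : Market) : ℝ :=
  if t.1 = s.1 + 1 then lamH / (lamH + lamE) * P Kind.H s t else 0

/-- The properties of a matching policy on which Little's law rests: an arrival adds at most one
waiting `H` agent, an `E` arrival adds none, and each waiting `H` agent may leave at the next
arrival. -/
structure IsPolicy (P : Kind → Market → Market → ℝ) : Prop where
  stochastic : ∀ k, IsStochastic (P k)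
  hard_le : ∀ s t : Market, s.1 + 1 < t.1 → P Kind.H s t = 0
  easy_le : ∀ s t : Market, s.1 < t.1 → P Kind.E s t = 0
  leave : ∀ s : Market, 0 < s.1 → ∃ k t, 0 < P k s t ∧ t.1 < s.1

theorem pt_eq_single (s : Market) : pt s = Pi.single s 1 := by
  funext t
  simp only [pt, Pi.single_apply]

theorem isFinDist_pt (s : Market) : IsFinDist (pt s) := pt_eq_single s ▸ .single s

theorem mean_pt (s : Market) (f : Market → ℝ) : mean (pt s) f = f s := by
  rw [mean, tsum_eq_single s fun t ht => by rw [pt, if_neg ht, zero_mul], pt, if_pos rfl, one_mul]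

theorem hasSum_mul_pt (π : Market → ℝ) (t : Market) : HasSum (fun s => π s * pt s t) (π t) := by
  have := hasSum_single (f := fun s => π s * pt s t) t fun s hs => by
    rw [pt, if_neg hs.symm, mul_zero]
  rwa [pt, if_pos rfl, mul_one] at this

theorem jumpProb_eq_mix (hl : lamH + lamE ≠ 0) (P : Kind → Market → Market → ℝ) (s t : Market) :
    jumpProb lamH lamE P s t = lamH / (lamH + lamE) * P Kind.H s t
      + (1 - lamH / (lamH + lamE)) * P Kind.E s t := by
  rw [jumpProb]
  field_simp
  ring

theorem isStochastic_jumpProb (hP : ∀ k, IsStochastic (P k)) (hH : 0 < lamH) (hE : 0 < lamE) :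
    IsStochastic (jumpProb lamH lamE P) := fun s => by
  rw [funext (jumpProb_eq_mix (by positivity) P s)]
  exact (hP Kind.H s).mix (hP Kind.E s) (by positivity)
    (div_le_one_of_le₀ (by linarith) (by positivity))

theorem mul_mean_jumpProb (hP : ∀ k, IsStochastic (P k)) (hl : lamH + lamE ≠ 0) (s : Market)
    (f : Market → ℝ) : (lamH + lamE) * mean (jumpProb lamH lamE P s) f
      = lamH * mean (P Kind.H s) f + lamE * mean (P Kind.E s) f := by
  rw [funext (jumpProb_eq_mix hl P s), (hP Kind.H s).mean_mix (hP Kind.E s)]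
  field_simp
  ring

theorem isSteadyState_iff (hP : ∀ k, IsStochastic (P k)) (hH : 0 < lamH) (hE : 0 < lamE) :
    IsSteadyState (rateMatrix lamH lamE P) π ↔ IsStationary (jumpProb lamH lamE P) π := by
  have hl : lamH + lamE ≠ 0 := by positivity
  have flow : ∀ s t, π s * rateMatrix lamH lamE P s t
      = (lamH + lamE) * (π s * jumpProb lamH lamE P s t - π s * pt s t) := fun s t => by
    rw [rateMatrix, jumpProb]
    field_simp
    ring
  have net_flow : ∀ t, Summable π → HasSum (fun s => π s * rateMatrix lamH lamE P s t)
      ((lamH + lamE) * (push π (jumpProb lamH lamE P) t - π t)) := fun t hπ => by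
    simp only [flow]
    exact (((isStochastic_jumpProb hP hH hE).hasSum_push_apply hπ t).sub
      (hasSum_mul_pt π t)).mul_left _
  constructor
  · rintro ⟨nonneg, total, balance⟩
    refine ⟨nonneg, total, funext fun t => ?_⟩
    have := (net_flow t total.summable).unique (balance t)
    exact sub_eq_zero.1 ((mul_eq_zero.1 this).resolve_left hl)
  · rintro ⟨nonneg, total, invariant⟩
    refine ⟨nonneg, total, fun t => ?_⟩
    simpa only [invariant, sub_self, mul_zero] using net_flow t total.summable

namespace IsPolicy

theorem jumpProb_mul_fst (hP : IsPolicy P) (lamH lamE : ℝ) (s t : Market) :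
    jumpProb lamH lamE P s t * t.1
      = s.1 * stayProb lamH lamE P s t + joinProb lamH lamE P s t := by
  have cancel : ∀ x : ℝ, (s.1 : ℝ) * (x * ((min s.1 t.1 : ℕ) / (s.1 : ℝ)))
      = x * (min s.1 t.1 : ℕ) := fun x => by
    rcases Nat.eq_zero_or_pos s.1 with hs | hs
    · simp only [hs, Nat.zero_min, Nat.cast_zero, zero_mul, mul_zero]
    · have : (s.1 : ℝ) ≠ 0 := by exact_mod_cast hs.ne'
      field_simp
  rw [stayProb, cancel, joinProb]
  rcases lt_trichotomy t.1 (s.1 + 1) with h | h | h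
  · rw [if_neg h.ne, min_eq_right (by omega), add_zero]
  · rw [if_pos h, min_eq_left (by omega), jumpProb, hP.easy_le s t (by omega), h]
    push_cast
    ring
  · rw [if_neg h.ne', jumpProb, hP.hard_le s t h, hP.easy_le s t (by omega)]
    simp only [mul_zero, add_zero, zero_div, zero_mul]

variable (hP : IsPolicy P) (hH : 0 < lamH) (hE : 0 < lamE)
include hP hH hE

theorem stayProb_nonneg (s t : Market) : 0 ≤ stayProb lamH lamE P s t :=
  mul_nonneg ((isStochastic_jumpProb hP.stochastic hH hE s).nonneg t) (by positivity)

theorem stayProb_le (s t : Market) : stayProb lamH lamE P s t ≤ jumpProb lamH lamE P s t :=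
  mul_le_of_le_one_right ((isStochastic_jumpProb hP.stochastic hH hE s).nonneg t)
    (div_le_one_of_le₀ (by exact_mod_cast min_le_left _ _) (by positivity))

theorem joinProb_nonneg (s t : Market) : 0 ≤ joinProb lamH lamE P s t := by
  have := (hP.stochastic Kind.H s).nonneg t
  rw [joinProb]
  split_ifs <;> positivity

theorem stay_nonneg (n : ℕ) (s : Market) : 0 ≤ stay lamH lamE P n s := by
  induction n generalizing s with
  | zero => exact zero_le_one
  | succ n ih =>
    rw [stay]
    exact tsum_nonneg fun t => mul_nonneg (hP.stayProb_nonneg hH hE s t) (ih t)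

theorem ofReal_stay (n : ℕ) (s : Market) : ENNReal.ofReal (stay lamH lamE P n s)
    = survival (fun s t => ENNReal.ofReal (stayProb lamH lamE P s t)) n s := by
  induction n generalizing s with
  | zero => rw [stay, survival, ENNReal.ofReal_one]
  | succ n ih =>
    have nonneg := hP.stayProb_nonneg hH hE s
    have finite_support :
        (fun t => stayProb lamH lamE P s t * stay lamH lamE P n t).support.Finite :=
      (isStochastic_jumpProb hP.stochastic hH hE s).finite_support.subset fun t ht =>
        left_ne_zero_of_mul (left_ne_zero_of_mul ht)
    rw [stay, survival]
    refine (ENNReal.ofReal_tsum_of_nonneg (fun t => mul_nonneg (nonneg t)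
      (hP.stay_nonneg hH hE n t)) (summable_of_hasFiniteSupport finite_support)).trans ?_
    exact tsum_congr fun t => by rw [ENNReal.ofReal_mul (nonneg t), ih]

theorem exists_stayProb_lt (s : Market) :
    ∃ t, stayProb lamH lamE P s t < jumpProb lamH lamE P s t := by
  have jump := isStochastic_jumpProb hP.stochastic hH hE s
  rcases Nat.eq_zero_or_pos s.1 with hs | hs
  · obtain ⟨t, ht⟩ : ∃ t, 0 < jumpProb lamH lamE P s t := by
      by_contra! nonpos
      exact absurd (hasSum_le nonpos jump.hasSum_one hasSum_zero) (by norm_num)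
    exact ⟨t, by rwa [stayProb, hs, Nat.cast_zero, div_zero, mul_zero]⟩
  · obtain ⟨k, t, hk, ht⟩ := hP.leave s hs
    have pos : 0 < jumpProb lamH lamE P s t := by
      have := (hP.stochastic Kind.H s).nonneg t
      have := (hP.stochastic Kind.E s).nonneg t
      rw [jumpProb]
      cases k <;> positivity
    refine ⟨t, mul_lt_of_lt_one_right pos ?_⟩
    rw [div_lt_one (by exact_mod_cast hs)]
    exact_mod_cast (min_le_right _ _).trans_lt ht

theorem tsum_stayProb_lt_one (s : Market) :
    ∑' t, ENNReal.ofReal (stayProb lamH lamE P s t) < 1 := by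
  have jump := isStochastic_jumpProb hP.stochastic hH hE s
  have nonneg := hP.stayProb_nonneg hH hE s
  have summable := jump.hasSum_one.summable.of_nonneg_of_le nonneg (hP.stayProb_le hH hE s)
  obtain ⟨t, ht⟩ := hP.exists_stayProb_lt hH hE s
  have lt_one : ∑' t, stayProb lamH lamE P s t < 1 :=
    hasSum_lt (hP.stayProb_le hH hE s) ht summable.hasSum jump.hasSum_one
  rw [← ENNReal.ofReal_tsum_of_nonneg nonneg summable]
  simpa only [ENNReal.ofReal_lt_one] using lt_one

theorem flow_balance (hπ : IsStationary (jumpProb lamH lamE P) π) (t : Market) :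
    push (fun s => ENNReal.ofReal (π s * s.1))
        (fun s t => ENNReal.ofReal (stayProb lamH lamE P s t)) t
      + push (fun s => ENNReal.ofReal (π s))
        (fun s t => ENNReal.ofReal (joinProb lamH lamE P s t)) t
      = ENNReal.ofReal (π t * t.1) := by
  have jump := isStochastic_jumpProb hP.stochastic hH hE
  have inflow := (jump.hasSum_push_apply hπ.hasSum_one.summable t).mul_right (t.1 : ℝ)
  rw [hπ.push_eq] at inflow
  rw [← inflow.tsum_eq, ENNReal.ofReal_tsum_of_nonneg (fun s => mul_nonneg
    (mul_nonneg (hπ.nonneg s) ((jump s).nonneg t)) (Nat.cast_nonneg _)) inflow.summable,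
    push, push, ← ENNReal.tsum_add]
  refine tsum_congr fun s => ?_
  have hπs := hπ.nonneg s
  have stay_nonneg := hP.stayProb_nonneg hH hE s t
  have join_nonneg := hP.joinProb_nonneg hH hE s t
  rw [← ENNReal.ofReal_mul (by positivity), ← ENNReal.ofReal_mul hπs,
    ← ENNReal.ofReal_add (by positivity) (by positivity), mul_assoc (π s) (jumpProb _ _ _ _ _),
    hP.jumpProb_mul_fst, mul_add, mul_assoc]

theorem remainingWait_eq (t : Market) : remainingWait lamH lamE P t
    = ENNReal.ofReal (lamH + lamE)⁻¹
      * ∑' n, survival (fun s t => ENNReal.ofReal (stayProb lamH lamE P s t)) n t := by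
  rw [remainingWait, ← ENNReal.tsum_mul_left]
  exact tsum_congr fun n => by
    rw [div_eq_inv_mul, ENNReal.ofReal_mul (by positivity), hP.ofReal_stay hH hE]

theorem ofReal_mul_join_remainingWait (s t : Market) : ENNReal.ofReal lamH *
      (if t.1 = s.1 + 1 then ENNReal.ofReal (P Kind.H s t) * remainingWait lamH lamE P t else 0)
    = ENNReal.ofReal (joinProb lamH lamE P s t)
      * ∑' n, survival (fun s t => ENNReal.ofReal (stayProb lamH lamE P s t)) n t := by
  rw [joinProb]
  split_ifs
  · rw [hP.remainingWait_eq hH hE, div_eq_mul_inv, mul_assoc lamH, ENNReal.ofReal_mul hH.le,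
      ENNReal.ofReal_mul (by positivity)]
    ring
  · rw [mul_zero, ENNReal.ofReal_zero, zero_mul]

theorem ofReal_mul_avgWaitH : ENNReal.ofReal lamH * avgWaitH lamH lamE P
    = ∑' n, ∑' t, push (fun s => ENNReal.ofReal (steadyState (rateMatrix lamH lamE P) s))
        (fun s t => ENNReal.ofReal (joinProb lamH lamE P s t)) t
      * survival (fun s t => ENNReal.ofReal (stayProb lamH lamE P s t)) n t := by
  have exchange : ∀ (m : Market → ℝ≥0∞) (w : ℕ → Market → ℝ≥0∞),
      ∑' n, ∑' t, m t * w n t = ∑' t, m t * ∑' n, w n t := fun m w => by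
    rw [ENNReal.tsum_comm]
    exact tsum_congr fun t => ENNReal.tsum_mul_left
  rw [exchange, tsum_push_mul, avgWaitH, ← ENNReal.tsum_mul_left]
  refine tsum_congr fun s => ?_
  rw [mul_left_comm, ← ENNReal.tsum_mul_left]
  exact congrArg _ (tsum_congr fun t => hP.ofReal_mul_join_remainingWait hH hE s t)

theorem avgWaitH_eq
    (hπ : IsStationary (jumpProb lamH lamE P) (steadyState (rateMatrix lamH lamE P)))
    (summable : Summable fun s : Market => steadyState (rateMatrix lamH lamE P) s * s.1) :
    avgWaitH lamH lamE P
      = ENNReal.ofReal (mean (steadyState (rateMatrix lamH lamE P)) (fun s => s.1) / lamH) := by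
  have number : ENNReal.ofReal (mean (steadyState (rateMatrix lamH lamE P)) fun s => s.1)
      = ∑' s : Market, ENNReal.ofReal (steadyState (rateMatrix lamH lamE P) s * s.1) :=
    ENNReal.ofReal_tsum_of_nonneg (fun s => mul_nonneg (hπ.nonneg s) (Nat.cast_nonneg _)) summable
  rw [ENNReal.ofReal_div_of_pos hH, ENNReal.eq_div_iff (ENNReal.ofReal_pos.2 hH).ne'
    ENNReal.ofReal_ne_top, hP.ofReal_mul_avgWaitH hH hE, number]
  exact tsum_tsum_mul_survival (hP.tsum_stayProb_lt_one hH hE)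
    (number ▸ ENNReal.ofReal_ne_top) (hP.flow_balance hH hE hπ)

end IsPolicy

end Policy

section Find

variable {p q : ℝ}

theorem find_zero (p : ℝ) : find p 0 = 0 := by rw [find, pow_zero, sub_self]

theorem one_sub_find (p : ℝ) (n : ℕ) : 1 - find p n = (1 - p) ^ n := sub_sub_cancel _ _

theorem find_nonneg (h0 : 0 ≤ p) (h1 : p ≤ 1) (n : ℕ) : 0 ≤ find p n :=
  sub_nonneg.2 (pow_le_one₀ (by linarith) (by linarith))

theorem find_le_one (h1 : p ≤ 1) (n : ℕ) : find p n ≤ 1 :=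
  sub_le_self _ (pow_nonneg (by linarith) n)

theorem find_pos (h0 : 0 < p) (h1 : p ≤ 1) {n : ℕ} (hn : n ≠ 0) : 0 < find p n :=
  sub_pos.2 (pow_lt_one₀ (by linarith) (by linarith) hn)

theorem find_le_mul (h1 : p ≤ 1) (n : ℕ) : find p n ≤ p * n := by
  have := one_add_mul_le_pow (a := -p) (by linarith) n
  rw [find, sub_eq_add_neg 1 p]
  linarith

theorem one_sub_find_le (hqp : q ≤ p) (h1 : p ≤ 1) (n : ℕ) : 1 - find p n ≤ (1 - q) ^ n := by
  rw [one_sub_find]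
  exact pow_le_pow_left₀ (by linarith) (by linarith) n

theorem find_mul_pred (p : ℝ) (n : ℕ) (F : ℝ → ℝ) :
    find p n * F (n - 1 : ℕ) = find p n * F (n - 1) := by
  cases n with
  | zero => rw [find_zero, zero_mul, zero_mul]
  | succ n => rw [Nat.add_sub_cancel, Nat.cast_succ, add_sub_cancel_right]

/-- The rate at which failure becomes unlikely with the number of trials: `find p n` is
`1 - exp (-(rate p * n))`. It is equivalent to `p` as `p` tends to `0`. -/
noncomputable def rate (p : ℝ) : ℝ := -Real.log (1 - p)

theorem le_rate (h1 : p < 1) : p ≤ rate p := by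
  have := Real.log_le_sub_one_of_pos (sub_pos.2 h1)
  rw [rate]
  linarith

theorem rate_pos (h0 : 0 < p) (h1 : p < 1) : 0 < rate p := h0.trans_le (le_rate h1)

theorem one_sub_pow_eq_exp (h1 : p < 1) (n : ℕ) : (1 - p) ^ n = Real.exp (-(rate p * n)) := by
  rw [rate, neg_mul, neg_neg, mul_comm, Real.exp_nat_mul, Real.exp_log (sub_pos.2 h1)]

theorem find_eq_exp (h1 : p < 1) (n : ℕ) : find p n = 1 - Real.exp (-(rate p * n)) := by
  rw [find, one_sub_pow_eq_exp h1]

theorem exists_mul_pow_le {μ : ℝ} (h0 : 0 ≤ μ) (h1 : μ < 1) :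
    ∃ M : ℝ, 0 ≤ M ∧ ∀ n : ℕ, n * μ ^ n ≤ M := by
  obtain ⟨M, hM⟩ := (tendsto_self_mul_const_pow_of_lt_one h0 h1).bddAbove_range
  have bound : ∀ n : ℕ, n * μ ^ n ≤ M := fun n => hM ⟨n, rfl⟩
  exact ⟨M, by simpa only [Nat.cast_zero, zero_mul] using bound 0, bound⟩

end Find

section Ergodicity

variable {lamH lamE : ℝ} {P : Kind → Market → Market → ℝ}

theorem jumpProb_pos (hP : ∀ k, IsStochastic (P k)) (hH : 0 < lamH) (hE : 0 < lamE) {k : Kind}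
    {s t : Market} (hk : 0 < P k s t) : 0 < jumpProb lamH lamE P s t := by
  have := (hP Kind.H s).nonneg t
  have := (hP Kind.E s).nonneg t
  rw [jumpProb]
  cases k <;> positivity

theorem reflTransGen_zero_of_shrink {R : Market → Market → Prop}
    (shrink : ∀ s, s ≠ (0, 0) → ∃ t, R s t ∧ t.1 + t.2 < s.1 + s.2) (s : Market) :
    Relation.ReflTransGen R s (0, 0) := by
  induction hn : s.1 + s.2 using Nat.strong_induction_on generalizing s with
  | _ n ih =>
    by_cases hs : s = (0, 0)
    · rw [hs]
    · obtain ⟨t, hst, ht⟩ := shrink s hs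
      exact .head hst (ih _ (hn ▸ ht) t rfl)

theorem finite_sublevel {g : Market → ℝ} (hg : ∀ s, (s.1 : ℝ) + s.2 ≤ g s) (M : ℝ) :
    {s | g s ≤ M}.Finite := by
  refine (Set.Finite.prod (Set.finite_Iic ⌊M⌋₊) (Set.finite_Iic ⌊M⌋₊)).subset fun s hs => ?_
  have hs : g s ≤ M := hs
  have total_le := hg s
  have : (0 : ℝ) ≤ s.1 := Nat.cast_nonneg _
  have : (0 : ℝ) ≤ s.2 := Nat.cast_nonneg _
  exact ⟨Nat.le_floor (by linarith), Nat.le_floor (by linarith)⟩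

variable (hP : ∀ k, IsStochastic (P k)) (hH : 0 < lamH) (hE : 0 < lamE) {f g : Market → ℝ} {C : ℝ}
  (hf : ∀ s, 0 ≤ f s) (hg : ∀ s, (s.1 : ℝ) + s.2 ≤ g s)
  (drift : ∀ s, mean (jumpProb lamH lamE P s) f ≤ f s - g s + C)

include hP hH hE hf hg drift in
theorem existsUnique_isSteadyState_of_drift
    (shrink : ∀ s, s ≠ (0, 0) → ∃ k t, 0 < P k s t ∧ t.1 + t.2 < s.1 + s.2) :
    ∃! π, IsSteadyState (rateMatrix lamH lamE P) π := by
  have jump := isStochastic_jumpProb hP hH hE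
  have g_nonneg : ∀ s, 0 ≤ g s := fun s => le_trans (by positivity) (hg s)
  obtain ⟨π, hπ⟩ := exists_isStationary_of_drift jump (0, 0) hf g_nonneg drift (finite_sublevel hg)
  refine ⟨π, (isSteadyState_iff hP hH hE).2 hπ, fun π' hπ' => ?_⟩
  refine ((isSteadyState_iff hP hH hE).1 hπ').unique jump (reflTransGen_zero_of_shrink ?_) hπ
  intro s hs
  obtain ⟨k, t, hk, ht⟩ := shrink s hs
  exact ⟨t, jumpProb_pos hP hH hE hk, ht⟩

include hP hH hE hf hg drift in
theorem summable_mul_fst_of_drift (hC : 0 ≤ C) {π : Market → ℝ}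
    (hπ : IsStationary (jumpProb lamH lamE P) π) : Summable fun s : Market => π s * s.1 := by
  have g_nonneg : ∀ s, 0 ≤ g s := fun s => le_trans (by positivity) (hg s)
  have summable := (hπ.mean_le_of_drift (isStochastic_jumpProb hP hH hE) hf g_nonneg hC drift).1
  refine summable.of_nonneg_of_le (fun s => mul_nonneg (hπ.nonneg s) (Nat.cast_nonneg _)) fun s =>
    mul_le_mul_of_nonneg_left ((le_add_of_nonneg_right (Nat.cast_nonneg _)).trans (hg s))
      (hπ.nonneg s)

end Ergodicity

/-! ### BilateralMatch(H) -/

section Bilateral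

variable {pH pE : ℝ} {k : Kind}

theorem acceptProb_pos (hH : 0 < pH) (hE : 0 < pE) (k : Kind) : 0 < acceptProb pH pE k := by
  cases k <;> assumption

theorem acceptProb_le_one (hH1 : pH ≤ 1) (hE1 : pE ≤ 1) (k : Kind) : acceptProb pH pE k ≤ 1 := by
  cases k <;> assumption

theorem min_le_acceptProb (pH pE : ℝ) (k : Kind) : min pH pE ≤ acceptProb pH pE k := by
  cases k
  · exact min_le_left _ _
  · exact min_le_right _ _

theorem isFinDist_bilateral_of_no_hard (s : Market) {b : ℝ} (hb0 : 0 ≤ b) (hb1 : b ≤ 1) :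
    IsFinDist fun t => b * pt (s.1, s.2 - 1) t + (1 - b) * pt (join k s) t :=
  (isFinDist_pt _).mix (isFinDist_pt _) hb0 hb1

theorem bilateralMatchH_eq_mix (s : Market) : bilateralMatchH pH pE k s = fun t =>
    find (acceptProb pH pE k * pH) s.1 * pt (s.1 - 1, s.2) t
      + (1 - find (acceptProb pH pE k * pH) s.1)
        * (find (acceptProb pH pE k * pE) s.2 * pt (s.1, s.2 - 1) t
          + (1 - find (acceptProb pH pE k * pE) s.2) * pt (join k s) t) :=
  funext fun t => by rw [bilateralMatchH]; ring

theorem eq_of_bilateralMatchH_ne_zero {s t : Market} (ht : bilateralMatchH pH pE k s t ≠ 0) :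
    t = (s.1 - 1, s.2) ∨ t = (s.1, s.2 - 1) ∨ t = join k s := by
  contrapose! ht
  obtain ⟨hard, easy, join⟩ := ht
  simp only [bilateralMatchH, pt, if_neg hard, if_neg easy, if_neg join, mul_zero, add_zero]

variable (hH : 0 < pH) (hH1 : pH ≤ 1) (hE : 0 < pE) (hE1 : pE ≤ 1)
include hH hH1 hE hE1

theorem find_acceptProb_mul_mem {q : ℝ} (hq : 0 < q) (hq1 : q ≤ 1) (n : ℕ) :
    0 ≤ find (acceptProb pH pE k * q) n ∧ find (acceptProb pH pE k * q) n ≤ 1 := by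
  have pos := acceptProb_pos hH hE k
  have le_one := mul_le_one₀ (acceptProb_le_one hH1 hE1 k) hq.le hq1
  exact ⟨find_nonneg (by positivity) le_one n, find_le_one le_one n⟩

theorem find_acceptProb_mul_pos {q : ℝ} (hq : 0 < q) (hq1 : q ≤ 1) {n : ℕ} (hn : n ≠ 0) :
    0 < find (acceptProb pH pE k * q) n :=
  find_pos (mul_pos (acceptProb_pos hH hE k) hq)
    (mul_le_one₀ (acceptProb_le_one hH1 hE1 k) hq.le hq1) hn

theorem isStochastic_bilateral (k : Kind) : IsStochastic (bilateralMatchH pH pE k) := fun s => by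
  obtain ⟨a0, a1⟩ := find_acceptProb_mul_mem hH hH1 hE hE1 (k := k) hH hH1 s.1
  obtain ⟨b0, b1⟩ := find_acceptProb_mul_mem hH hH1 hE hE1 (k := k) hE hE1 s.2
  rw [bilateralMatchH_eq_mix]
  exact (isFinDist_pt _).mix (isFinDist_bilateral_of_no_hard s b0 b1) a0 a1

theorem mean_bilateral (s : Market) (F : ℝ → ℝ → ℝ) :
    mean (bilateralMatchH pH pE k s) (fun t => F t.1 t.2)
      = find (acceptProb pH pE k * pH) s.1 * F (s.1 - 1) s.2
        + (1 - find (acceptProb pH pE k * pH) s.1)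
          * (find (acceptProb pH pE k * pE) s.2 * F s.1 (s.2 - 1)
            + (1 - find (acceptProb pH pE k * pE) s.2) * F (join k s).1 (join k s).2) := by
  obtain ⟨b0, b1⟩ := find_acceptProb_mul_mem hH hH1 hE hE1 (k := k) hE hE1 s.2
  rw [bilateralMatchH_eq_mix, (isFinDist_pt _).mean_mix (isFinDist_bilateral_of_no_hard s b0 b1),
    (isFinDist_pt _).mean_mix (isFinDist_pt _), mean_pt, mean_pt, mean_pt,
    find_mul_pred _ s.1 fun x => F x s.2, find_mul_pred _ s.2 fun x => F s.1 x]

theorem bilateral_hard_pos {s : Market} (hs : s.1 ≠ 0) :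
    0 < bilateralMatchH pH pE k s (s.1 - 1, s.2) := by
  obtain ⟨-, a1⟩ := find_acceptProb_mul_mem hH hH1 hE hE1 (k := k) hH hH1 s.1
  obtain ⟨b0, b1⟩ := find_acceptProb_mul_mem hH hH1 hE hE1 (k := k) hE hE1 s.2
  rw [bilateralMatchH_eq_mix]
  refine add_pos_of_pos_of_nonneg ?_ (mul_nonneg (sub_nonneg.2 a1)
    ((isFinDist_bilateral_of_no_hard s b0 b1).nonneg _))
  rw [pt, if_pos rfl, mul_one]
  exact find_acceptProb_mul_pos hH hH1 hE hE1 hH hH1 hs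

theorem bilateral_easy_pos {e : ℕ} : 0 < bilateralMatchH pH pE k (0, e + 1) (0, e) := by
  obtain ⟨-, b1⟩ := find_acceptProb_mul_mem hH hH1 hE hE1 (k := k) hE hE1 (e + 1)
  rw [bilateralMatchH_eq_mix]
  dsimp only
  rw [find_zero, zero_mul, zero_add, sub_zero, one_mul, Nat.add_sub_cancel]
  refine add_pos_of_pos_of_nonneg ?_ (mul_nonneg (sub_nonneg.2 b1) ((isFinDist_pt _).nonneg _))
  rw [pt, if_pos rfl, mul_one]
  exact find_acceptProb_mul_pos hH hH1 hE hE1 hE hE1 e.succ_ne_zero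

theorem isPolicy_bilateral : IsPolicy (bilateralMatchH pH pE) where
  stochastic := isStochastic_bilateral hH hH1 hE hE1
  hard_le s t ht := by
    by_contra h
    obtain rfl | rfl | rfl := eq_of_bilateralMatchH_ne_zero h <;> simp only [join] at ht <;> omega
  easy_le s t ht := by
    by_contra h
    obtain rfl | rfl | rfl := eq_of_bilateralMatchH_ne_zero h <;> simp only [join] at ht <;> omega
  leave s hs :=
    ⟨Kind.H, (s.1 - 1, s.2), bilateral_hard_pos hH hH1 hE hE1 hs.ne', Nat.pred_lt hs.ne'⟩

theorem bilateral_shrink {s : Market} (hs : s ≠ (0, 0)) :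
    ∃ k t, 0 < bilateralMatchH pH pE k s t ∧ t.1 + t.2 < s.1 + s.2 := by
  obtain ⟨h, e⟩ := s
  rcases h with _ | h
  · obtain ⟨e, rfl⟩ := Nat.exists_eq_succ_of_ne_zero fun he : e = 0 => hs (by rw [he])
    exact ⟨Kind.E, (0, e), bilateral_easy_pos hH hH1 hE hE1, by dsimp only; omega⟩
  · exact ⟨Kind.H, (h, e), bilateral_hard_pos hH hH1 hE hE1 h.succ_ne_zero, by dsimp only; omega⟩

theorem mean_bilateral_sq_total_le {M : ℝ}
    (hM : ∀ n : ℕ, n * (1 - min pH pE * min pH pE) ^ n ≤ M) (k : Kind) (s : Market) :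
    mean (bilateralMatchH pH pE k s) (fun t => ((t.1 : ℝ) + t.2) ^ 2)
      ≤ ((s.1 : ℝ) + s.2) ^ 2 - (s.1 + s.2) + (1 + 4 * M) := by
  have p_pos : 0 < min pH pE := lt_min hH hE
  have p_le_one : min pH pE ≤ 1 := (min_le_left _ _).trans hH1
  have pp_le_one := mul_le_one₀ p_le_one p_pos.le p_le_one
  have acc_le_one := acceptProb_le_one hH1 hE1 k
  have acc_pos := acceptProb_pos hH hE k
  have no_hard := one_sub_find_le (mul_le_mul (min_le_acceptProb pH pE k) (min_le_left pH pE)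
    p_pos.le acc_pos.le) (mul_le_one₀ acc_le_one hH.le hH1) s.1
  have no_easy := one_sub_find_le (mul_le_mul (min_le_acceptProb pH pE k) (min_le_right pH pE)
    p_pos.le acc_pos.le) (mul_le_one₀ acc_le_one hE.le hE1) s.2
  have join_total : ((join k s).1 : ℝ) + (join k s).2 = s.1 + s.2 + 1 := by
    cases k <;> simp only [join, Nat.cast_add, Nat.cast_one] <;> ring
  obtain ⟨-, b1⟩ := find_acceptProb_mul_mem hH hH1 hE hE1 (k := k) hE hE1 s.2
  rw [mean_bilateral hH hH1 hE hE1 s fun x y => (x + y) ^ 2, join_total]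
  generalize find (acceptProb pH pE k * pH) s.1 = a at *
  generalize find (acceptProb pH pE k * pE) s.2 = b at *
  have total_nonneg : (0 : ℝ) ≤ s.1 + s.2 := by positivity
  have join_le : (1 - a) * (1 - b) ≤ (1 - min pH pE * min pH pE) ^ (s.1 + s.2) := by
    rw [pow_add]
    exact mul_le_mul no_hard no_easy (by linarith) (pow_nonneg (by linarith) _)
  have weighted : ((s.1 : ℝ) + s.2) * ((1 - a) * (1 - b)) ≤ M :=
    (mul_le_mul_of_nonneg_left join_le total_nonneg).trans
      (by exact_mod_cast hM (s.1 + s.2))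
  linarith

variable {lamH lamE : ℝ} (hlH : 0 < lamH) (hlE : 0 < lamE)
include hlH hlE

theorem exists_bilateral_drift : ∃ C : ℝ, 0 ≤ C ∧ ∀ s,
    mean (jumpProb lamH lamE (bilateralMatchH pH pE) s) (fun t => ((t.1 : ℝ) + t.2) ^ 2)
      ≤ ((s.1 : ℝ) + s.2) ^ 2 - (s.1 + s.2) + C := by
  have p_pos : 0 < min pH pE := lt_min hH hE
  have p_le_one : min pH pE ≤ 1 := (min_le_left _ _).trans hH1
  obtain ⟨M, hM0, hM⟩ := exists_mul_pow_le (sub_nonneg.2 (mul_le_one₀ p_le_one p_pos.le p_le_one))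
    (sub_lt_self 1 (mul_pos p_pos p_pos))
  refine ⟨1 + 4 * M, by positivity, fun s => ?_⟩
  have arrival := fun k => mean_bilateral_sq_total_le hH hH1 hE hE1 hM k s
  refine le_of_mul_le_mul_left ?_ (add_pos hlH hlE)
  rw [mul_mean_jumpProb (isStochastic_bilateral hH hH1 hE hE1) (by positivity), add_mul]
  exact add_le_add (mul_le_mul_of_nonneg_left (arrival Kind.H) hlH.le)
    (mul_le_mul_of_nonneg_left (arrival Kind.E) hlE.le)

theorem bilateral_existsUnique_isSteadyState :
    ∃! π, IsSteadyState (rateMatrix lamH lamE (bilateralMatchH pH pE)) π := by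
  obtain ⟨C, -, drift⟩ := exists_bilateral_drift hH hH1 hE hE1 hlH hlE
  exact existsUnique_isSteadyState_of_drift (isStochastic_bilateral hH hH1 hE hE1) hlH hlE
    (fun _ => sq_nonneg _) (fun _ => le_rfl) drift fun _ => bilateral_shrink hH hH1 hE hE1

theorem bilateral_summable_mul_fst {π : Market → ℝ}
    (hπ : IsStationary (jumpProb lamH lamE (bilateralMatchH pH pE)) π) :
    Summable fun s : Market => π s * s.1 := by
  obtain ⟨C, hC, drift⟩ := exists_bilateral_drift hH hH1 hE hE1 hlH hlE
  exact summable_mul_fst_of_drift (isStochastic_bilateral hH hH1 hE hE1) hlH hlE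
    (fun _ => sq_nonneg _) (fun _ => le_rfl) drift hC hπ

end Bilateral

section BilateralDrift

theorem hard_departure_pull_le {p h z e a b c Y ρ : ℝ} (hY : 0 ≤ Y) (hρ : 0 < ρ) (hp : 0 ≤ p)
    (hz : 0 ≤ z) (hzY : z * p ≤ Y) (e0 : 0 ≤ e) (a0 : 0 ≤ a) (b0 : 0 ≤ b) (h0 : 0 ≤ h)
    (b1 : b ≤ 1) (c1 : c ≤ 1) (ha : a ≤ p * p * h) (hb : b ≤ p * e) (hc : h < z → ρ ≤ 1 - c) :
    2 * (z - h) * (2 * a + b - a * b) ≤ 4 * Y ^ 2 + 2 * (Y / ρ) * (e * (1 - c)) := by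
  have rhs_nonneg : 0 ≤ 2 * (Y / ρ) * (e * (1 - c)) := by
    have := sub_nonneg.2 c1
    positivity
  have departures_nonneg : 0 ≤ 2 * a + b - a * b := by nlinarith
  rcases le_or_gt z h with hzh | hhz
  · nlinarith [mul_nonneg (sub_nonneg.2 hzh) departures_nonneg]
  have hard : z * a ≤ Y * Y := calc
    z * a ≤ z * (p * p * h) := by gcongr
    _ = z * p * (p * h) := by ring
    _ ≤ z * p * (p * z) := by gcongr
    _ = z * p * (z * p) := by ring
    _ ≤ Y * Y := by gcongr
  have easy : z * b ≤ Y / ρ * (e * (1 - c)) := calc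
    z * b ≤ z * (p * e) := by gcongr
    _ = z * p * e := by ring
    _ ≤ Y * e := by gcongr
    _ = Y / ρ * (e * ρ) := by field_simp
    _ ≤ Y / ρ * (e * (1 - c)) := by gcongr; exact hc hhz
  have : (z - h) * (2 * a + b - a * b) ≤ z * (2 * a + b) :=
    mul_le_mul (by linarith) (by nlinarith) departures_nonneg hz
  linarith

variable {pH pE : ℝ} (hH : 0 < pH) (hH1 : pH ≤ 1) (hE : 0 < pE) (hE1 : pE ≤ 1)
include hH hH1 hE hE1

theorem mean_bilateral_hard_sq_fst (z : ℝ) (s : Market) :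
    mean (bilateralMatchH pH pE Kind.H s) (fun t => ((t.1 : ℝ) - z) ^ 2)
      ≤ ((s.1 : ℝ) - z) ^ 2 + 1 + 2 * (s.1 - z)
        + 2 * (z - s.1) * (2 * find (pH * pH) s.1 + find (pH * pE) s.2
          - find (pH * pH) s.1 * find (pH * pE) s.2) := by
  obtain ⟨a0, a1⟩ := find_acceptProb_mul_mem hH hH1 hE hE1 (k := Kind.H) hH hH1 s.1
  obtain ⟨b0, b1⟩ := find_acceptProb_mul_mem hH hH1 hE hE1 (k := Kind.H) hE hE1 s.2
  rw [mean_bilateral hH hH1 hE hE1 s fun x _ => (x - z) ^ 2]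
  simp only [acceptProb, join, Nat.cast_add, Nat.cast_one] at a0 a1 b0 b1 ⊢
  linarith [mul_nonneg b0 (sub_nonneg.2 a1)]

theorem mean_bilateral_easy_sq_fst (z : ℝ) (s : Market) :
    mean (bilateralMatchH pH pE Kind.E s) (fun t => ((t.1 : ℝ) - z) ^ 2)
      = ((s.1 : ℝ) - z) ^ 2 + find (pE * pH) s.1 * (1 - 2 * (s.1 - z)) := by
  rw [mean_bilateral hH hH1 hE hE1 s fun x _ => (x - z) ^ 2]
  simp only [acceptProb, join]
  ring

theorem mean_bilateral_hard_sq_snd (s : Market) :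
    mean (bilateralMatchH pH pE Kind.H s) (fun t => (t.2 : ℝ) ^ 2) ≤ (s.2 : ℝ) ^ 2 + 1 := by
  obtain ⟨a0, a1⟩ := find_acceptProb_mul_mem hH hH1 hE hE1 (k := Kind.H) hH hH1 s.1
  obtain ⟨b0, b1⟩ := find_acceptProb_mul_mem hH hH1 hE hE1 (k := Kind.H) hE hE1 s.2
  rw [mean_bilateral hH hH1 hE hE1 s fun _ y => y ^ 2]
  simp only [acceptProb, join] at a0 a1 b0 b1 ⊢
  have easy_nonneg := mul_nonneg (sub_nonneg.2 a1) b0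
  linarith [mul_le_one₀ (sub_le_self 1 a0) b0 b1,
    mul_nonneg easy_nonneg (Nat.cast_nonneg (α := ℝ) s.2)]

theorem mean_bilateral_easy_sq_snd {M : ℝ} (hM : ∀ n : ℕ, n * (1 - pE * pE) ^ n ≤ M) (s : Market) :
    mean (bilateralMatchH pH pE Kind.E s) (fun t => (t.2 : ℝ) ^ 2)
      ≤ (s.2 : ℝ) ^ 2 + (1 + 4 * M) - 2 * (s.2 * (1 - find (pE * pH) s.1)) := by
  obtain ⟨c0, c1⟩ := find_acceptProb_mul_mem hH hH1 hE hE1 (k := Kind.E) hH hH1 s.1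
  obtain ⟨d0, d1⟩ := find_acceptProb_mul_mem hH hH1 hE hE1 (k := Kind.E) hE hE1 s.2
  have bound := hM s.2
  rw [← one_sub_find] at bound
  rw [mean_bilateral hH hH1 hE hE1 s fun _ y => y ^ 2]
  simp only [acceptProb, join, Nat.cast_add, Nat.cast_one] at c0 c1 d0 d1 ⊢
  have failure : (1 - find (pE * pH) s.1) * (s.2 * (1 - find (pE * pE) s.2)) ≤ M :=
    (mul_le_of_le_one_left (mul_nonneg (Nat.cast_nonneg _) (sub_nonneg.2 d1))
      (sub_le_self _ c0)).trans bound
  linarith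

omit hH1 in
theorem bilateral_pull_le (hlt : pH < 1) {y : ℝ} (hy : 0 < y) (s : Market) :
    2 * (y / rate (pE * pH) - s.1) * (2 * find (pH * pH) s.1 + find (pH * pE) s.2
        - find (pH * pH) s.1 * find (pH * pE) s.2)
      ≤ 4 * (y / pE) ^ 2
        + 2 * (y / pE / Real.exp (-y)) * (s.2 * (1 - find (pE * pH) s.1)) := by
  have hH1 := hlt.le
  have prod_lt : pE * pH < 1 := mul_lt_one_of_nonneg_of_lt_one_right hE1 hH.le hlt
  have θ_pos := rate_pos (mul_pos hE hH) prod_lt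
  obtain ⟨a0, -⟩ := find_acceptProb_mul_mem hH hH1 hE hE1 (k := Kind.H) hH hH1 s.1
  obtain ⟨b0, b1⟩ := find_acceptProb_mul_mem hH hH1 hE hE1 (k := Kind.H) hE hE1 s.2
  obtain ⟨-, c1⟩ := find_acceptProb_mul_mem hH hH1 hE hE1 (k := Kind.E) hH hH1 s.1
  have easy_le : find (pH * pE) s.2 ≤ pH * s.2 := (find_le_mul (mul_le_one₀ hH1 hE.le hE1) _).trans
    (mul_le_mul_of_nonneg_right (mul_le_of_le_one_right hH.le hE1) (Nat.cast_nonneg _))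
  have root_le : y / rate (pE * pH) * pH ≤ y / pE := by
    rw [div_mul_eq_mul_div, div_le_div_iff₀ θ_pos hE, mul_assoc, mul_comm pH]
    exact mul_le_mul_of_nonneg_left (le_rate prod_lt) hy.le
  have below_root : (s.1 : ℝ) < y / rate (pE * pH) →
      Real.exp (-y) ≤ 1 - find (pE * pH) s.1 := fun hs => by
    rw [find_eq_exp prod_lt, sub_sub_cancel, Real.exp_le_exp, neg_le_neg_iff]
    exact (mul_comm _ _).trans_le ((lt_div_iff₀ θ_pos).1 hs).le
  exact hard_departure_pull_le (by positivity) (Real.exp_pos _) hH.le (by positivity) root_le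
    (Nat.cast_nonneg _) a0 b0 (Nat.cast_nonneg _) b1 c1 (find_le_mul (mul_le_one₀ hH1 hH.le hH1) _)
    easy_le below_root

end BilateralDrift

section BilateralMean

variable {lamH lamE pH pE : ℝ}

/-- The drift of the number of waiting `H` agents under BilateralMatch(H), with the sign reversed,
when the scaled number `rate (pE * pH) * h` of `H` agents is `x`; only the cycles between an
arriving `E` agent and a waiting `H` agent matter at leading order. -/
noncomputable def bilateralDrift (lamH lamE x : ℝ) : ℝ := lamE * (1 - Real.exp (-x)) - lamH

theorem bilateralDrift_strictMono (hE : 0 < lamE) : StrictMono (bilateralDrift lamH lamE) :=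
  fun x y hxy => by
    have : Real.exp (-y) < Real.exp (-x) := Real.exp_lt_exp.2 (neg_lt_neg hxy)
    simp only [bilateralDrift]
    nlinarith

theorem bilateralDrift_rate (hH : 0 < lamH) (hlt : lamH < lamE) :
    bilateralDrift lamH lamE (rate (lamH / lamE)) = 0 := by
  have hE := hH.trans hlt
  rw [bilateralDrift, rate, neg_neg, Real.exp_log (sub_pos.2 ((div_lt_one hE).2 hlt))]
  field_simp
  ring

theorem sub_mul_nonneg_of_root {m : ℝ → ℝ} {I : Set ℝ} (hm : MonotoneOn m I) {x y : ℝ}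
    (hx : x ∈ I) (hy : y ∈ I) (root : m y = 0) : 0 ≤ (x - y) * m x := by
  rcases le_total x y with h | h
  · exact mul_nonneg_of_nonpos_of_nonpos (sub_nonpos.2 h) (root ▸ hm hx hy h)
  · exact mul_nonneg (sub_nonneg.2 h) (root ▸ hm hy hx h)

theorem bilateral_sq_fst_drift (hlH : 0 < lamH) (hlE : 0 < lamE) (hH : 0 < pH) (hlt : pH < 1)
    (hE : 0 < pE) (hE1 : pE ≤ 1) {y : ℝ} (hy : 0 < y) (s : Market) :
    (lamH + lamE) * mean (jumpProb lamH lamE (bilateralMatchH pH pE) s)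
        (fun t => ((t.1 : ℝ) - y / rate (pE * pH)) ^ 2)
      ≤ (lamH + lamE) * ((s.1 : ℝ) - y / rate (pE * pH)) ^ 2
        - 2 * ((s.1 - y / rate (pE * pH)) * bilateralDrift lamH lamE (rate (pE * pH) * s.1))
        + (lamH * (1 + 4 * (y / pE) ^ 2) + lamE)
        + 2 * (lamH * (y / pE / Real.exp (-y))) * (s.2 * (1 - find (pE * pH) s.1)) := by
  have prod_lt : pE * pH < 1 := mul_lt_one_of_nonneg_of_lt_one_right hE1 hH.le hlt
  have hard := mul_le_mul_of_nonneg_left ((mean_bilateral_hard_sq_fst hH hlt.le hE hE1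
    (y / rate (pE * pH)) s).trans (add_le_add le_rfl (bilateral_pull_le hH hE hE1 hlt hy s))) hlH.le
  have easy_le := mul_le_mul_of_nonneg_left (find_le_one (mul_le_one₀ hE1 hH.le hlt.le) s.1) hlE.le
  rw [mul_mean_jumpProb (isStochastic_bilateral hH hlt.le hE hE1) (by positivity),
    mean_bilateral_easy_sq_fst hH hlt.le hE hE1, bilateralDrift, ← find_eq_exp prod_lt]
  linarith

theorem bilateral_sq_snd_drift (hlH : 0 < lamH) (hlE : 0 < lamE) (hH : 0 < pH) (hH1 : pH ≤ 1)
    (hE : 0 < pE) (hE1 : pE ≤ 1) {M : ℝ} (hM : ∀ n : ℕ, n * (1 - pE * pE) ^ n ≤ M) (s : Market) :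
    (lamH + lamE) * mean (jumpProb lamH lamE (bilateralMatchH pH pE) s) (fun t => (t.2 : ℝ) ^ 2)
      ≤ (lamH + lamE) * (s.2 : ℝ) ^ 2 + (lamH + lamE * (1 + 4 * M))
        - 2 * lamE * (s.2 * (1 - find (pE * pH) s.1)) := by
  have hard := mul_le_mul_of_nonneg_left (mean_bilateral_hard_sq_snd hH hH1 hE hE1 s) hlH.le
  have easy := mul_le_mul_of_nonneg_left (mean_bilateral_easy_sq_snd hH hH1 hE hE1 hM s) hlE.le
  rw [mul_mean_jumpProb (isStochastic_bilateral hH hH1 hE hE1) (by positivity)]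
  linarith

theorem exists_bilateral_sq_drift (hlH : 0 < lamH) (hlE : 0 < lamE) (hE : 0 < pE) (hE1 : pE ≤ 1)
    {y : ℝ} (hy : 0 < y) : ∃ A C : ℝ, 0 ≤ A ∧ 0 ≤ C ∧ ∀ pH, 0 < pH → pH < 1 → ∀ s : Market,
    (lamH + lamE) * mean (jumpProb lamH lamE (bilateralMatchH pH pE) s)
        (fun t => ((t.1 : ℝ) - y / rate (pE * pH)) ^ 2 + A * (t.2 : ℝ) ^ 2)
      ≤ (lamH + lamE) * (((s.1 : ℝ) - y / rate (pE * pH)) ^ 2 + A * (s.2 : ℝ) ^ 2)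
        - 2 * ((s.1 - y / rate (pE * pH)) * bilateralDrift lamH lamE (rate (pE * pH) * s.1))
        + C := by
  obtain ⟨M, hM0, hM⟩ := exists_mul_pow_le (sub_nonneg.2 (mul_le_one₀ hE1 hE.le hE1))
    (sub_lt_self 1 (mul_pos hE hE))
  -- This weight of the `E` agents cancels the pull of their cycles with arriving `H` agents.
  set A := lamH * (y / pE / Real.exp (-y)) / lamE
  have A_mul : A * lamE = lamH * (y / pE / Real.exp (-y)) := div_mul_cancel₀ _ hlE.ne'
  have A_nonneg : 0 ≤ A := by positivity
  refine ⟨A, lamH * (1 + 4 * (y / pE) ^ 2) + lamE + A * (lamH + lamE * (1 + 4 * M)), A_nonneg,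
    by positivity, fun pH hH hlt s => ?_⟩
  have fst_drift := bilateral_sq_fst_drift hlH hlE hH hlt hE hE1 hy s
  have snd_drift := mul_le_mul_of_nonneg_left
    (bilateral_sq_snd_drift hlH hlE hH hlt.le hE hE1 hM s) A_nonneg
  have jump := isStochastic_jumpProb (isStochastic_bilateral hH hlt.le hE hE1) hlH hlE
  rw [← A_mul] at fst_drift
  rw [(jump s).mean_add, mean_const_mul]
  linarith

theorem exists_bilateral_mean_drift_le (hlH : 0 < lamH) (hlt : lamH < lamE) (hE : 0 < pE)
    (hE1 : pE ≤ 1) : ∃ C : ℝ, 0 ≤ C ∧ ∀ pH, 0 < pH → pH < 1 → ∀ π,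
    IsStationary (jumpProb lamH lamE (bilateralMatchH pH pE)) π →
      Summable (fun s => π s * ((rate (pE * pH) * s.1 - rate (lamH / lamE))
        * bilateralDrift lamH lamE (rate (pE * pH) * s.1))) ∧
      mean π (fun s => (rate (pE * pH) * s.1 - rate (lamH / lamE))
        * bilateralDrift lamH lamE (rate (pE * pH) * s.1)) ≤ C * rate (pE * pH) := by
  have hlE := hlH.trans hlt
  have y_pos := rate_pos (div_pos hlH hlE) ((div_lt_one hlE).2 hlt)
  obtain ⟨A, C, hA, hC, sq_drift⟩ := exists_bilateral_sq_drift hlH hlE hE hE1 y_pos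
  refine ⟨C / 2, by positivity, fun pH hH hlt1 π hπ => ?_⟩
  have θ_pos := rate_pos (mul_pos hE hH) (mul_lt_one_of_nonneg_of_lt_one_right hE1 hH.le hlt1)
  have jump := isStochastic_jumpProb (isStochastic_bilateral hH hlt1.le hE hE1) hlH hlE
  have total_pos := add_pos hlH hlE
  set c := 2 / (rate (pE * pH) * (lamH + lamE)) with hc
  have c_pos : 0 < c := by positivity
  have gain_nonneg := fun s : Market => mul_nonneg c_pos.le (sub_mul_nonneg_of_root
    ((bilateralDrift_strictMono hlE).monotone.monotoneOn Set.univ) (x := rate (pE * pH) * s.1)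
    (Set.mem_univ _) (Set.mem_univ _) (bilateralDrift_rate hlH hlt))
  obtain ⟨summable, le⟩ := hπ.mean_le_of_drift jump (m := 0)
    (f := fun t => ((t.1 : ℝ) - rate (lamH / lamE) / rate (pE * pH)) ^ 2 + A * (t.2 : ℝ) ^ 2)
    (fun s => by positivity) gain_nonneg
    (C := C / (lamH + lamE)) (by positivity) fun s => by
      refine le_of_mul_le_mul_left ((sq_drift pH hH hlt1 s).trans_eq ?_) total_pos
      rw [hc]
      field_simp
  refine ⟨(summable.mul_left c⁻¹).congr fun s => ?_, ?_⟩
  · rw [mul_left_comm, inv_mul_cancel_left₀ c_pos.ne']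
  · rw [mean_const_mul] at le
    refine le_of_mul_le_mul_left (le.trans_eq ?_) c_pos
    rw [hc]
    field_simp

end BilateralMean

/-! ### ChainMatch(d) -/

section Segment

theorem segmentEnd_eq_mix (pH pE : ℝ) (h e : ℕ) : segmentEnd pH pE h e = fun t =>
    find pH h * segmentEnd pH pE (h - 1) e t
      + (1 - find pH h) * (find pE e * segmentEnd pH pE h (e - 1) t
        + (1 - find pE e) * pt (h, e) t) := by
  funext t
  rcases h with _ | h <;> rcases e with _ | e <;> rw [segmentEnd] <;>
    simp only [find_zero, Nat.add_sub_cancel] <;> ring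

theorem segment_induction {motive : ℕ → ℕ → Prop}
    (step : ∀ h e, (h ≠ 0 → motive (h - 1) e) → (e ≠ 0 → motive h (e - 1)) → motive h e)
    (h e : ℕ) : motive h e := by
  induction hn : h + e using Nat.strong_induction_on generalizing h e with
  | _ n ih => exact step h e (fun _ => ih _ (by omega) _ _ rfl) fun _ => ih _ (by omega) _ _ rfl

theorem find_mul_le_find_mul {p : ℝ} (h0 : 0 ≤ p) (h1 : p ≤ 1) {n : ℕ} {x y : ℝ}
    (hxy : n ≠ 0 → x ≤ y) : find p n * x ≤ find p n * y := by
  rcases eq_or_ne n 0 with rfl | hn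
  · rw [find_zero, zero_mul, zero_mul]
  · exact mul_le_mul_of_nonneg_left (hxy hn) (find_nonneg h0 h1 n)

theorem find_mul_congr {p : ℝ} {n : ℕ} {x y : ℝ} (hxy : n ≠ 0 → x = y) :
    find p n * x = find p n * y := by
  rcases eq_or_ne n 0 with rfl | hn
  · rw [find_zero, zero_mul, zero_mul]
  · rw [hxy hn]

theorem isFinDist_find_mix {S : Type*} {q r : S → ℝ} {p : ℝ} (h0 : 0 ≤ p) (h1 : p ≤ 1) {n : ℕ}
    (hq : n ≠ 0 → IsFinDist q) (hr : IsFinDist r) :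
    IsFinDist fun t => find p n * q t + (1 - find p n) * r t := by
  rcases eq_or_ne n 0 with rfl | hn
  · simpa only [find_zero, zero_mul, zero_add, sub_zero, one_mul] using hr
  · exact (hq hn).mix hr (find_nonneg h0 h1 n) (find_le_one h1 n)

theorem segmentEnd_eq_zero_of_lt (pH pE : ℝ) (h e : ℕ) {t : Market} (ht : h < t.1) :
    segmentEnd pH pE h e t = 0 := by
  induction h, e using segment_induction with
  | step h e hard easy =>
    have hard : find pH h * segmentEnd pH pE (h - 1) e t = find pH h * 0 :=
      find_mul_congr fun h0 => hard h0 (by omega)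
    have easy : find pE e * segmentEnd pH pE h (e - 1) t = find pE e * 0 :=
      find_mul_congr fun e0 => easy e0 ht
    have ended : pt (h, e) t = 0 := if_neg fun eq => ht.ne' (by rw [eq])
    rw [segmentEnd_eq_mix]
    dsimp only
    rw [hard, easy, ended]
    ring

variable {pH pE : ℝ} (hH : 0 < pH) (hH1 : pH ≤ 1) (hE : 0 < pE) (hE1 : pE ≤ 1)
include hH hH1 hE hE1

theorem isFinDist_segmentEnd (h e : ℕ) : IsFinDist (segmentEnd pH pE h e) := by
  induction h, e using segment_induction with
  | step h e hard easy =>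
    rw [segmentEnd_eq_mix]
    exact isFinDist_find_mix hH.le hH1 hard (isFinDist_find_mix hE.le hE1 easy (isFinDist_pt _))

theorem segmentEnd_zero_pos (h e : ℕ) : 0 < segmentEnd pH pE h e (0, 0) := by
  induction h, e using segment_induction with
  | step h e hard easy =>
    have easy_nonneg := (isFinDist_segmentEnd hH hH1 hE hE1 h (e - 1)).nonneg (0, 0)
    have stop_nonneg := (isFinDist_pt (h, e)).nonneg (0, 0)
    have find_nonneg := find_nonneg hE.le hE1 e
    have hard_fail := sub_nonneg.2 (find_le_one hH1 h)
    have easy_fail := sub_nonneg.2 (find_le_one hE1 e)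
    rw [segmentEnd_eq_mix]
    dsimp only
    rcases eq_or_ne h 0 with rfl | h0
    · rw [find_zero, zero_mul, zero_add, sub_zero, one_mul]
      rcases eq_or_ne e 0 with rfl | e0
      · rw [find_zero, zero_mul, zero_add, sub_zero, one_mul, pt, if_pos rfl]
        exact one_pos
      · exact add_pos_of_pos_of_nonneg (mul_pos (find_pos hE hE1 e0) (easy e0)) (by positivity)
    · exact add_pos_of_pos_of_nonneg (mul_pos (find_pos hH hH1 h0) (hard h0)) (by positivity)

theorem mean_segmentEnd (h e : ℕ) (f : Market → ℝ) :
    mean (segmentEnd pH pE h e) f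
      = find pH h * mean (segmentEnd pH pE (h - 1) e) f
        + (1 - find pH h) * (find pE e * mean (segmentEnd pH pE h (e - 1)) f
          + (1 - find pE e) * f (h, e)) := by
  have dist := isFinDist_segmentEnd hH hH1 hE hE1
  rw [segmentEnd_eq_mix, (dist _ _).mean_mix (isFinDist_find_mix hE.le hE1 (fun _ => dist _ _)
    (isFinDist_pt _)), (dist _ _).mean_mix (isFinDist_pt _), mean_pt]

theorem mean_segmentEnd_le_of_supersolution {f : Market → ℝ} {U : ℕ → ℕ → ℝ}
    (hU : ∀ h e, find pH h * U (h - 1) e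
      + (1 - find pH h) * (find pE e * U h (e - 1) + (1 - find pE e) * f (h, e)) ≤ U h e)
    (h e : ℕ) : mean (segmentEnd pH pE h e) f ≤ U h e := by
  induction h, e using segment_induction with
  | step h e hard easy =>
    rw [mean_segmentEnd hH hH1 hE hE1]
    refine le_trans (add_le_add (find_mul_le_find_mul hH.le hH1 hard) ?_) (hU h e)
    exact mul_le_mul_of_nonneg_left (add_le_add_left (find_mul_le_find_mul hE.le hE1 easy) _)
      (sub_nonneg.2 (find_le_one hH1 h))

end Segment

section Chain

variable {pH pE : ℝ} (hH : 0 < pH) (hH1 : pH ≤ 1) (hE : 0 < pE) (hE1 : pE ≤ 1) (d : ℕ)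
include hH hH1 hE hE1

theorem isStochastic_chain (k : Kind) : IsStochastic (chainMatch d pH pE k) := fun s =>
  isFinDist_find_mix (acceptProb_pos hH hE k).le (acceptProb_le_one hH1 hE1 k)
    (fun _ => isFinDist_segmentEnd hH hH1 hE hE1 s.1 s.2) (isFinDist_pt (join k s))

theorem mean_chain (k : Kind) (s : Market) (f : Market → ℝ) :
    mean (chainMatch d pH pE k s) f
      = find (acceptProb pH pE k) d * mean (segmentEnd pH pE s.1 s.2) f
        + (1 - find (acceptProb pH pE k) d) * f (join k s) := by
  rw [← mean_pt (join k s) f]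
  exact (isFinDist_segmentEnd hH hH1 hE hE1 s.1 s.2).mean_mix (isFinDist_pt _) _ f

theorem chain_drift_le_of_segment {lamH lamE : ℝ} (hlH : 0 < lamH) (hlE : 0 < lamE)
    {f : Market → ℝ} {s : Market} {L : ℝ} (hL : mean (segmentEnd pH pE s.1 s.2) f ≤ f s - L) :
    (lamH + lamE) * mean (jumpProb lamH lamE (chainMatch d pH pE) s) f
      ≤ (lamH + lamE) * f s + lamH * (1 - find pH d) * (f (s.1 + 1, s.2) - f s)
        + lamE * (1 - find pE d) * (f (s.1, s.2 + 1) - f s)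
        - (lamH * find pH d + lamE * find pE d) * L := by
  rw [mul_mean_jumpProb (isStochastic_chain hH hH1 hE hE1 d) (by positivity),
    mean_chain hH hH1 hE hE1, mean_chain hH hH1 hE hE1]
  have hard := mul_le_mul_of_nonneg_left hL (mul_nonneg hlH.le (find_nonneg hH.le hH1 d))
  have easy := mul_le_mul_of_nonneg_left hL (mul_nonneg hlE.le (find_nonneg hE.le hE1 d))
  simp only [acceptProb, join]
  linarith

variable {d} (hd : 1 ≤ d)
include hd

theorem chain_zero_pos (k : Kind) (s : Market) : 0 < chainMatch d pH pE k s (0, 0) := by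
  have pos := acceptProb_pos hH hE k
  have le_one := acceptProb_le_one hH1 hE1 k
  exact add_pos_of_pos_of_nonneg
    (mul_pos (find_pos pos le_one (by omega)) (segmentEnd_zero_pos hH hH1 hE hE1 s.1 s.2))
    (mul_nonneg (sub_nonneg.2 (find_le_one le_one d)) ((isFinDist_pt _).nonneg _))

theorem isPolicy_chain : IsPolicy (chainMatch d pH pE) where
  stochastic := isStochastic_chain hH hH1 hE hE1 d
  hard_le s t ht := by
    have joined : pt (join Kind.H s) t = 0 := if_neg fun eq => by subst eq; exact ht.ne rfl
    rw [chainMatch, joined, segmentEnd_eq_zero_of_lt pH pE s.1 s.2 (by omega)]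
    ring
  easy_le s t ht := by
    have joined : pt (join Kind.E s) t = 0 := if_neg fun eq => by subst eq; exact ht.ne rfl
    rw [chainMatch, joined, segmentEnd_eq_zero_of_lt pH pE s.1 s.2 ht]
    ring
  leave s hs := ⟨Kind.H, (0, 0), chain_zero_pos hH hH1 hE hE1 hd Kind.H s, hs⟩

theorem chain_shrink {s : Market} (hs : s ≠ (0, 0)) :
    ∃ k t, 0 < chainMatch d pH pE k s t ∧ t.1 + t.2 < s.1 + s.2 := by
  refine ⟨Kind.H, (0, 0), chain_zero_pos hH hH1 hE hE1 hd Kind.H s,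
    Nat.pos_of_ne_zero fun h => hs ?_⟩
  obtain ⟨h1, h2⟩ := Nat.add_eq_zero_iff.1 h
  exact Prod.ext h1 h2

end Chain

section RunLoss

/-- The sum `b 0 + ⋯ + b n`: taking one agent away from `n` waiting ones lowers it by `b n`. -/
noncomputable def psum (b : ℕ → ℝ) (n : ℕ) : ℝ := ∑ j ∈ Finset.range (n + 1), b j

theorem psum_succ (b : ℕ → ℝ) (n : ℕ) : psum b (n + 1) = psum b n + b (n + 1) :=
  Finset.sum_range_succ _ _

theorem psum_pred (b : ℕ → ℝ) {n : ℕ} (hn : n ≠ 0) : psum b (n - 1) = psum b n - b n := by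
  obtain ⟨n, rfl⟩ := Nat.exists_eq_succ_of_ne_zero hn
  rw [Nat.succ_eq_add_one, psum_succ, Nat.add_sub_cancel, add_sub_cancel_right]

theorem psum_nonneg {b : ℕ → ℝ} (hb : ∀ n, 0 ≤ b n) (n : ℕ) : 0 ≤ psum b n :=
  Finset.sum_nonneg fun _ _ => hb _

theorem le_psum {b : ℕ → ℝ} (hb : ∀ n, 0 ≤ b n) (n : ℕ) : b n ≤ psum b n :=
  Finset.single_le_sum (f := b) (fun _ _ => hb _) (Finset.self_mem_range_succ n)

/-- `W n` bounds from below the mean decrease of `psum b` over a chain-segment that takes agents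
away from `n` waiting ones, each of whom finds an item compatible with probability `p`. -/
structure IsRunLoss (p : ℝ) (b W : ℕ → ℝ) : Prop where
  nonneg : ∀ n, 0 ≤ W n
  le : ∀ n, W n ≤ find p n * (b n + W (n - 1))

theorem isRunLoss_of_slow_growth {p : ℝ} (h0 : 0 ≤ p) (h1 : p ≤ 1) {b : ℕ → ℝ} {C D : ℝ}
    (hb : ∀ n, 0 ≤ b n) (hD : 0 ≤ D)
    (likely : ∀ n, D < C * b n → (1 - p) ^ n * (2 * (C + 1)) ≤ 1)
    (slow : ∀ n, D < C * b n → C * (b n - b (n - 1)) ≤ b n / 2) :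
    IsRunLoss p b fun n => max 0 (C * b n - D) where
  nonneg n := le_max_left _ _
  le n := by
    have found := find_nonneg h0 h1 n
    refine max_le (mul_nonneg found (add_nonneg (hb n) (le_max_left _ _))) ?_
    rcases le_or_gt (C * b n) D with small | large
    · exact (sub_nonpos.2 small).trans (mul_nonneg found (add_nonneg (hb n) (le_max_left _ _)))
    · have fail_nonneg : 0 ≤ (1 - p) ^ n := pow_nonneg (sub_nonneg.2 h1) n
      have fail_small := mul_le_mul_of_nonneg_right (likely n large) (hb n)
      have previous : C * b n - b n / 2 - D ≤ max 0 (C * b (n - 1) - D) :=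
        le_trans (by linarith [slow n large]) (le_max_right _ _)
      refine le_trans ?_ (mul_le_mul_of_nonneg_left (add_le_add_right previous (b n)) found)
      rw [find]
      have lost : (1 - p) ^ n * (C * b n + b n / 2 - D) ≤ b n / 2 := by
        have := mul_nonneg fail_nonneg (hb n)
        have := mul_nonneg fail_nonneg hD
        linarith
      linarith

theorem exists_isRunLoss_sq {p : ℝ} (h0 : 0 < p) (h1 : p ≤ 1) {C : ℝ} (hC : 0 < C) :
    ∃ D : ℝ, 0 ≤ D ∧ IsRunLoss p (fun n => (n : ℝ) ^ 2) fun n => max 0 (C * (n : ℝ) ^ 2 - D) := by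
  have vanish : Tendsto (fun n : ℕ => (1 - p) ^ n * (2 * (C + 1))) atTop (𝓝 0) := by
    simpa only [zero_mul] using (tendsto_pow_atTop_nhds_zero_of_lt_one (sub_nonneg.2 h1)
      (sub_lt_self 1 h0)).mul_const (2 * (C + 1))
  obtain ⟨N, hN⟩ := eventually_atTop.1 (vanish.eventually (ge_mem_nhds one_pos))
  have large : ∀ n : ℕ, C * ((N + ⌈4 * C⌉₊ : ℕ) : ℝ) ^ 2 < C * (n : ℝ) ^ 2 →
      N + ⌈4 * C⌉₊ < n := fun n hn => by
    exact_mod_cast lt_of_pow_lt_pow_left₀ 2 n.cast_nonneg (lt_of_mul_lt_mul_left hn hC.le)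
  refine ⟨C * ((N + ⌈4 * C⌉₊ : ℕ) : ℝ) ^ 2, by positivity, isRunLoss_of_slow_growth h0.le h1
    (fun n => sq_nonneg _) (by positivity) (fun n hn => hN n ?_) fun n hn => ?_⟩
  · have := large n hn
    omega
  · have lt := large n hn
    have le_n : 4 * C ≤ n := (Nat.le_ceil _).trans (by exact_mod_cast (by omega : ⌈4 * C⌉₊ ≤ n))
    rw [Nat.cast_sub (by omega), Nat.cast_one]
    have := mul_le_mul_of_nonneg_right le_n n.cast_nonneg
    linarith

theorem isRunLoss_linear {p K C : ℝ} (h0 : 0 < p) (h1 : p < 1) (hC : 0 < C)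
    (hK : Real.exp (-K) * (2 * (C + 1)) ≤ 1) :
    IsRunLoss p (fun n => max 0 (rate p * n - K))
      fun n => max 0 (C * max 0 (rate p * n - K) - 2 * C ^ 2 * rate p) := by
  have rate_pos := rate_pos h0 h1
  have large : ∀ n : ℕ, 2 * C ^ 2 * rate p < C * max 0 (rate p * n - K) →
      2 * C * rate p < max 0 (rate p * n - K) := fun n hn => by
    refine lt_of_mul_lt_mul_left (lt_of_eq_of_lt ?_ hn) hC.le
    ring
  have above : ∀ n : ℕ, 2 * C ^ 2 * rate p < C * max 0 (rate p * n - K) →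
      0 < rate p * n - K := fun n hn => by
    have := (by positivity : 0 < 2 * C * rate p).trans (large n hn)
    exact (lt_max_iff.1 this).resolve_left (lt_irrefl 0)
  refine isRunLoss_of_slow_growth h0.le h1.le (fun n => le_max_left _ _) (by positivity)
    (fun n hn => ?_) fun n hn => ?_
  · rw [one_sub_pow_eq_exp h1]
    refine (mul_le_mul_of_nonneg_right (Real.exp_le_exp.2 ?_) (by positivity)).trans hK
    linarith [above n hn]
  · have step : max 0 (rate p * n - K) - max 0 (rate p * (n - 1 : ℕ) - K) ≤ rate p := by
      have cast_le : (n : ℝ) ≤ (n - 1 : ℕ) + 1 := by exact_mod_cast (by omega : n ≤ n - 1 + 1)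
      have := mul_le_mul_of_nonneg_left cast_le rate_pos.le
      rw [max_eq_right (above n hn).le]
      linarith [le_max_right 0 (rate p * (n - 1 : ℕ) - K)]
    have := mul_le_mul_of_nonneg_left step hC.le
    linarith [large n hn]

end RunLoss

section ChainDrift

theorem arrival_sub_loss_le {l lam Q D : ℝ} (hl : 0 < l) (hlam : lam ≤ l) (hQ : 0 < Q) (n : ℕ) :
    lam * ((n + 1 : ℕ) : ℝ) ^ 2 - Q * (3 * l / Q * (n : ℝ) ^ 2 - D)
      ≤ l * (-(n : ℝ) ^ 2 + (2 + Q * D / l)) := by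
  have loss : Q * (3 * l / Q * (n : ℝ) ^ 2 - D) = 3 * l * (n : ℝ) ^ 2 - Q * D := by field_simp
  have const : l * (-(n : ℝ) ^ 2 + (2 + Q * D / l)) = l * (2 - (n : ℝ) ^ 2) + Q * D := by
    field_simp
    ring
  have arrival : lam * ((n + 1 : ℕ) : ℝ) ^ 2 ≤ l * (2 * (n : ℝ) ^ 2 + 2) := by
    refine mul_le_mul hlam ?_ (sq_nonneg _) hl.le
    push_cast
    linarith [sq_nonneg ((n : ℝ) - 1)]
  rw [loss, const]
  linarith

theorem mul_le_add_mul_max {a b : ℝ} (ha : 0 ≤ a) (hb : 0 ≤ b) (x : ℝ) :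
    b * x ≤ (a + b) * max 0 x :=
  (mul_le_mul_of_nonneg_left (le_max_right 0 x) hb).trans
    (mul_le_mul_of_nonneg_right (le_add_of_nonneg_left ha) (le_max_left 0 x))

variable {pE : ℝ} (hE : 0 < pE) (hE1 : pE ≤ 1) {d : ℕ} (hd : 1 ≤ d)
  {lamH lamE : ℝ} (hlH : 0 < lamH) (hlE : 0 < lamE)

section Segment

variable {pH : ℝ} (hH : 0 < pH) (hH1 : pH ≤ 1)
include hH hH1 hE hE1

theorem mean_segmentEnd_psum_fst {b W : ℕ → ℝ} (hW : IsRunLoss pH b W) (s : Market) :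
    mean (segmentEnd pH pE s.1 s.2) (fun t => psum b t.1) ≤ psum b s.1 - W s.1 := by
  refine mean_segmentEnd_le_of_supersolution hH hH1 hE hE1 (U := fun h _ => psum b h - W h)
    (fun h e => ?_) s.1 s.2
  have hard : find pH h * (psum b (h - 1) - W (h - 1)) = find pH h * (psum b h - b h - W (h - 1)) :=
    find_mul_congr fun h0 => by rw [psum_pred b h0]
  have loss := hW.le h
  have easy : 0 ≤ (1 - find pH h) * (find pE e * W h) := by
    have := sub_nonneg.2 (find_le_one hH1 h)
    have := find_nonneg hE.le hE1 e
    have := hW.nonneg h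
    positivity
  dsimp only
  rw [hard]
  linarith

theorem mean_segmentEnd_psum_snd {b W : ℕ → ℝ} (hW : IsRunLoss pE b W) (s : Market) :
    mean (segmentEnd pH pE s.1 s.2) (fun t => psum b t.2) ≤ psum b s.2 - W s.2 := by
  refine mean_segmentEnd_le_of_supersolution hH hH1 hE hE1 (U := fun _ e => psum b e - W e)
    (fun h e => ?_) s.1 s.2
  have easy : find pE e * (psum b (e - 1) - W (e - 1)) = find pE e * (psum b e - b e - W (e - 1)) :=
    find_mul_congr fun e0 => by rw [psum_pred b e0]
  have loss := mul_le_mul_of_nonneg_left (hW.le e) (sub_nonneg.2 (find_le_one hH1 h))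
  dsimp only
  rw [easy]
  linarith

include hlH hlE

theorem chain_drift_psum_fst {b : ℕ → ℝ} {C D : ℝ} (hb : ∀ n, 0 ≤ b n)
    (hW : IsRunLoss pH b fun n => max 0 (C * b n - D)) (s : Market) :
    (lamH + lamE) * mean (jumpProb lamH lamE (chainMatch d pH pE) s) (fun t => psum b t.1)
      ≤ (lamH + lamE) * psum b s.1
        + (lamH * b (s.1 + 1) - lamE * find pE d * (C * b s.1 - D)) := by
  have drift := chain_drift_le_of_segment hH hH1 hE hE1 d hlH hlE (f := fun t => psum b t.1)
    (mean_segmentEnd_psum_fst hE hE1 hH hH1 hW s)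
  have loss := mul_le_add_mul_max (mul_nonneg hlH.le (find_nonneg hH.le hH1 d))
    (mul_nonneg hlE.le (find_nonneg hE.le hE1 d)) (C * b s.1 - D)
  have arrival : 0 ≤ lamH * find pH d * b (s.1 + 1) :=
    mul_nonneg (mul_nonneg hlH.le (find_nonneg hH.le hH1 d)) (hb _)
  simp only [psum_succ] at drift
  linarith

theorem chain_drift_psum_snd {b : ℕ → ℝ} {C D : ℝ} (hb : ∀ n, 0 ≤ b n)
    (hW : IsRunLoss pE b fun n => max 0 (C * b n - D)) (s : Market) :
    (lamH + lamE) * mean (jumpProb lamH lamE (chainMatch d pH pE) s) (fun t => psum b t.2)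
      ≤ (lamH + lamE) * psum b s.2
        + (lamE * b (s.2 + 1) - lamE * find pE d * (C * b s.2 - D)) := by
  have drift := chain_drift_le_of_segment hH hH1 hE hE1 d hlH hlE (f := fun t => psum b t.2)
    (mean_segmentEnd_psum_snd hE hE1 hH hH1 hW s)
  have loss := mul_le_add_mul_max (mul_nonneg hlH.le (find_nonneg hH.le hH1 d))
    (mul_nonneg hlE.le (find_nonneg hE.le hE1 d)) (C * b s.2 - D)
  have arrival : 0 ≤ lamE * find pE d * b (s.2 + 1) :=
    mul_nonneg (mul_nonneg hlE.le (find_nonneg hE.le hE1 d)) (hb _)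
  simp only [psum_succ] at drift
  linarith

include hd

theorem exists_chain_sq_fst_drift : ∃ C : ℝ, 0 ≤ C ∧ ∀ s : Market,
    mean (jumpProb lamH lamE (chainMatch d pH pE) s) (fun t => psum (fun n => (n : ℝ) ^ 2) t.1)
      ≤ psum (fun n => (n : ℝ) ^ 2) s.1 - (s.1 : ℝ) ^ 2 + C := by
  have Q_pos : 0 < lamE * find pE d := mul_pos hlE (find_pos hE hE1 (by omega))
  obtain ⟨D, hD, hW⟩ := exists_isRunLoss_sq hH hH1
    (C := 3 * (lamH + lamE) / (lamE * find pE d)) (by positivity)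
  refine ⟨2 + lamE * find pE d * D / (lamH + lamE), by positivity, fun s => ?_⟩
  have drift := chain_drift_psum_fst hE hE1 hlH hlE hH hH1 (d := d) (fun n => sq_nonneg _) hW s
  have := arrival_sub_loss_le (D := D) (add_pos hlH hlE) (le_add_of_nonneg_right hlE.le) Q_pos s.1
  refine le_of_mul_le_mul_left ?_ (add_pos hlH hlE)
  linarith

end Segment

include hE hE1 hd hlH hlE

theorem exists_chain_sq_snd_drift : ∃ C : ℝ, 0 ≤ C ∧ ∀ pH : ℝ, 0 < pH → pH ≤ 1 → ∀ s : Market,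
    mean (jumpProb lamH lamE (chainMatch d pH pE) s) (fun t => psum (fun n => (n : ℝ) ^ 2) t.2)
      ≤ psum (fun n => (n : ℝ) ^ 2) s.2 - (s.2 : ℝ) ^ 2 + C := by
  have Q_pos : 0 < lamE * find pE d := mul_pos hlE (find_pos hE hE1 (by omega))
  obtain ⟨D, hD, hW⟩ := exists_isRunLoss_sq hE hE1
    (C := 3 * (lamH + lamE) / (lamE * find pE d)) (by positivity)
  refine ⟨2 + lamE * find pE d * D / (lamH + lamE), by positivity, fun pH hH hH1 s => ?_⟩
  have drift := chain_drift_psum_snd hE hE1 hlH hlE hH hH1 (d := d) (fun n => sq_nonneg _) hW s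
  have := arrival_sub_loss_le (D := D) (add_pos hlH hlE) (le_add_of_nonneg_left hlH.le) Q_pos s.2
  refine le_of_mul_le_mul_left ?_ (add_pos hlH hlE)
  linarith

section Stationary

variable {pH : ℝ} (hH : 0 < pH) (hH1 : pH ≤ 1)
include hH hH1

theorem exists_chain_drift : ∃ C : ℝ, 0 ≤ C ∧ ∀ s : Market,
    mean (jumpProb lamH lamE (chainMatch d pH pE) s)
        (fun t => psum (fun n => (n : ℝ) ^ 2) t.1 + psum (fun n => (n : ℝ) ^ 2) t.2)
      ≤ psum (fun n => (n : ℝ) ^ 2) s.1 + psum (fun n => (n : ℝ) ^ 2) s.2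
        - ((s.1 : ℝ) ^ 2 + (s.2 : ℝ) ^ 2) + C := by
  obtain ⟨C₁, hC₁, hard⟩ := exists_chain_sq_fst_drift hE hE1 hd hlH hlE hH hH1
  obtain ⟨C₂, hC₂, easy⟩ := exists_chain_sq_snd_drift hE hE1 hd hlH hlE
  refine ⟨C₁ + C₂, add_nonneg hC₁ hC₂, fun s => ?_⟩
  rw [(isStochastic_jumpProb (isStochastic_chain hH hH1 hE hE1 d) hlH hlE s).mean_add]
  linarith [hard s, easy pH hH hH1 s]

omit hE hE1 hd hlH hlE hH hH1 in
theorem add_le_sq_add_sq (m n : ℕ) : (m : ℝ) + n ≤ (m : ℝ) ^ 2 + (n : ℝ) ^ 2 := by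
  exact_mod_cast add_le_add (Nat.le_self_pow two_ne_zero m) (Nat.le_self_pow two_ne_zero n)

theorem chain_existsUnique_isSteadyState :
    ∃! π, IsSteadyState (rateMatrix lamH lamE (chainMatch d pH pE)) π := by
  obtain ⟨C, -, drift⟩ := exists_chain_drift hE hE1 hd hlH hlE hH hH1
  exact existsUnique_isSteadyState_of_drift (isStochastic_chain hH hH1 hE hE1 d) hlH hlE
    (fun _ => add_nonneg (psum_nonneg (fun _ => sq_nonneg _) _)
      (psum_nonneg (fun _ => sq_nonneg _) _)) (fun s => add_le_sq_add_sq s.1 s.2) drift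
    fun _ => chain_shrink hH hH1 hE hE1 hd

theorem chain_summable_mul_fst {π : Market → ℝ}
    (hπ : IsStationary (jumpProb lamH lamE (chainMatch d pH pE)) π) :
    Summable fun s : Market => π s * s.1 := by
  obtain ⟨C, hC, drift⟩ := exists_chain_drift hE hE1 hd hlH hlE hH hH1
  exact summable_mul_fst_of_drift (isStochastic_chain hH hH1 hE hE1 d) hlH hlE
    (fun _ => add_nonneg (psum_nonneg (fun _ => sq_nonneg _) _)
      (psum_nonneg (fun _ => sq_nonneg _) _)) (fun s => add_le_sq_add_sq s.1 s.2) drift hC hπ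

end Stationary

theorem exists_chain_tail_mean_le : ∃ K C : ℝ, 0 ≤ K ∧ 0 ≤ C ∧ ∀ pH : ℝ, 0 < pH → pH < 1 → ∀ π,
    IsStationary (jumpProb lamH lamE (chainMatch d pH pE)) π →
      Summable (fun s : Market => π s * max 0 (rate pH * s.1 - K)) ∧
      mean π (fun s => max 0 (rate pH * s.1 - K)) ≤ C * rate pH := by
  have Q_pos : 0 < lamE * find pE d := mul_pos hlE (find_pos hE hE1 (by omega))
  have l_pos := add_pos hlH hlE
  set Q := lamE * find pE d
  set c := (lamH + (lamH + lamE)) / Q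
  have c_pos : 0 < c := by positivity
  have Q_mul_c : Q * c = lamH + (lamH + lamE) := mul_div_cancel₀ _ Q_pos.ne'
  set K := Real.log (2 * (c + 1)) with hK
  refine ⟨K, (lamH + Q * (2 * c ^ 2)) / (lamH + lamE), Real.log_nonneg (by linarith),
    by positivity, fun pH hH hH1 π hπ => ?_⟩
  have θ_pos := rate_pos hH hH1
  have loss := isRunLoss_linear (K := K) hH hH1 c_pos (by
    rw [hK, Real.exp_neg, Real.exp_log (by positivity), inv_mul_cancel₀ (by positivity)])
  have tail_nonneg : ∀ n : ℕ, 0 ≤ max 0 (rate pH * n - K) := fun n => le_max_left _ _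
  refine hπ.mean_le_of_drift (isStochastic_jumpProb (isStochastic_chain hH hH1.le hE hE1 d) hlH hlE)
    (m := 0) (f := fun s : Market => psum (fun n => max 0 (rate pH * n - K)) s.1)
    (fun s => psum_nonneg tail_nonneg _) (fun s => tail_nonneg _) (by positivity) fun s => ?_
  have drift := chain_drift_psum_fst hE hE1 hlH hlE hH hH1.le (d := d) tail_nonneg loss s
  have step : max 0 (rate pH * (s.1 + 1 : ℕ) - K) ≤ max 0 (rate pH * s.1 - K) + rate pH := by
    refine max_le (add_nonneg (tail_nonneg _) θ_pos.le) ?_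
    push_cast
    linarith [le_max_right 0 (rate pH * s.1 - K)]
  have arrival := mul_le_mul_of_nonneg_left step hlH.le
  refine le_of_mul_le_mul_left ?_ l_pos
  rw [mul_add, mul_sub, ← mul_assoc, mul_div_cancel₀ _ l_pos.ne']
  generalize max 0 (rate pH * s.1 - K) = b at *
  have : Q * (c * b - 2 * c ^ 2 * rate pH) = Q * c * b - Q * (2 * c ^ 2) * rate pH := by ring
  rw [Q_mul_c] at this
  linarith

end ChainDrift

section Compensation

theorem rate_le_one {p : ℝ} (h1 : p ≤ 1 / 2) : rate p ≤ 1 := by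
  have log_le : Real.log (1 / 2) ≤ Real.log (1 - p) :=
    Real.log_le_log (by norm_num) (by linarith)
  rw [one_div, Real.log_inv] at log_le
  rw [rate]
  linarith [Real.log_two_lt_d9]

theorem exp_sub_one_pos {x : ℝ} (hx : 0 < x) : 0 < Real.exp x - 1 :=
  sub_pos.2 (Real.one_lt_exp_iff.2 hx)

/-- The limiting drift of the rescaled number of waiting `H` agents under ChainMatch, with the sign
reversed and divided by the mean number `exp x - 1` of `H` agents taken by one run of a segment. -/
noncomputable def chainDrift (lamH lamE x : ℝ) : ℝ := lamE - lamH / (Real.exp x - 1)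

/-- The zero of `chainDrift`. -/
noncomputable def chainRoot (lamH lamE : ℝ) : ℝ := Real.log (1 + lamH / lamE)

/-- The deviation of `θ * n` from `y`, truncated from above at `1`. -/
noncomputable def dev (y θ : ℝ) (n : ℕ) : ℝ := min (θ * n - y) 1

/-- `dev`, weighted with the odds `exp (-θ n) / (1 - exp (-θ n))` against finding one of `n`
agents. -/
noncomputable def oddsDev (y θ : ℝ) (n : ℕ) : ℝ := dev y θ n / (Real.exp (θ * n) - 1)

/-- A Lyapunov function whose drift is, up to lower order, minus the product of the deviation of
the number of waiting `H` agents and `chainDrift`. The second summand credits each waiting `E` agent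
with the run of `H` agents that she will cause when a segment takes her. -/
noncomputable def chainPotential (y θ : ℝ) (s : Market) : ℝ :=
  psum (oddsDev y θ) s.1 - s.2 * dev y θ s.1

variable {lamH lamE : ℝ}

theorem chainDrift_strictMonoOn (lamE : ℝ) (hlH : 0 < lamH) :
    StrictMonoOn (chainDrift lamH lamE) (Set.Ioi 0) := fun _ hx _ _ hxy =>
  sub_lt_sub_left (div_lt_div_of_pos_left hlH (exp_sub_one_pos hx)
    (sub_lt_sub_right (Real.exp_lt_exp.2 hxy) 1)) lamE

theorem chainRoot_pos (hlH : 0 < lamH) (hlE : 0 < lamE) : 0 < chainRoot lamH lamE :=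
  Real.log_pos (lt_add_of_pos_right 1 (div_pos hlH hlE))

theorem chainDrift_chainRoot (hlH : 0 < lamH) (hlE : 0 < lamE) :
    chainDrift lamH lamE (chainRoot lamH lamE) = 0 := by
  rw [chainDrift, chainRoot, Real.exp_log (by positivity), add_sub_cancel_left,
    div_div_cancel₀ hlH.ne', sub_self]

theorem min_sub_one_mul_nonneg_of_root {m : ℝ → ℝ} {I : Set ℝ} (hm : MonotoneOn m I) {x y : ℝ}
    (hx : x ∈ I) (hy : y ∈ I) (root : m y = 0) : 0 ≤ min (x - y) 1 * m x := by
  rcases le_total x y with h | h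
  · exact mul_nonneg_of_nonpos_of_nonpos ((min_le_left _ _).trans (sub_nonpos.2 h))
      (root ▸ hm hx hy h)
  · exact mul_nonneg (le_min (sub_nonneg.2 h) zero_le_one) (root ▸ hm hy hx h)

section Dev

variable {y θ : ℝ}

theorem dev_le_one (y θ : ℝ) (n : ℕ) : dev y θ n ≤ 1 := min_le_right _ _

theorem neg_le_dev (hy : 0 ≤ y) (hθ : 0 ≤ θ) (n : ℕ) : -y ≤ dev y θ n :=
  le_min (by linarith [mul_nonneg hθ n.cast_nonneg]) (by linarith)

theorem dev_zero_nonpos (hy : 0 ≤ y) (θ : ℝ) : dev y θ 0 ≤ 0 := by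
  refine (min_le_left _ _).trans ?_
  rw [Nat.cast_zero, mul_zero, zero_sub]
  exact neg_nonpos.2 hy

theorem dev_le_dev_succ (hθ : 0 ≤ θ) (n : ℕ) : dev y θ n ≤ dev y θ (n + 1) := by
  refine min_le_min ?_ le_rfl
  push_cast
  linarith

theorem dev_succ_le (hθ : 0 ≤ θ) (n : ℕ) : dev y θ (n + 1) ≤ dev y θ n + θ := by
  rw [dev, dev, ← min_add_add_right]
  refine min_le_min ?_ (by linarith)
  push_cast
  linarith

theorem mul_oddsDev (lamH lamE y θ : ℝ) (n : ℕ) :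
    lamH * oddsDev y θ n = lamE * dev y θ n - dev y θ n * chainDrift lamH lamE (θ * n) := by
  rw [oddsDev, chainDrift]
  ring

theorem oddsDev_nonneg (hθ : 0 < θ) (hy : 0 < y) {n : ℕ} (hn : ⌈y / θ⌉₊ ≤ n) :
    0 ≤ oddsDev y θ n := by
  have le_mul : y ≤ θ * n := by
    rw [mul_comm]
    exact (div_le_iff₀ hθ).1 (Nat.ceil_le.1 hn)
  exact div_nonneg (le_min (by linarith) zero_le_one) (exp_sub_one_pos (by linarith)).le

end Dev

section Find

variable {p : ℝ}

theorem find_mul_oddsDev (h0 : 0 < p) (h1 : p < 1) (y : ℝ) {n : ℕ} (hn : n ≠ 0) :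
    find p n * oddsDev y (rate p) n = (1 - find p n) * dev y (rate p) n := by
  have exp_sub_one := exp_sub_one_pos
    (mul_pos (rate_pos h0 h1) (Nat.cast_pos.2 (Nat.pos_of_ne_zero hn)))
  rw [find_eq_exp h1, Real.exp_neg, oddsDev]
  field_simp
  ring

theorem find_mul_dev_sub_le (h0 : 0 < p) (h2 : p ≤ 1 / 2) (y : ℝ) (n : ℕ) :
    find p (n + 1) * (dev y (rate p) (n + 1) - dev y (rate p) n)
      ≤ (1 - find p (n + 1)) * (rate p * Real.exp (y + 2)) := by
  have h1 : p < 1 := by linarith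
  have rate_pos := rate_pos h0 h1
  have found := find_nonneg h0.le h1.le (n + 1)
  have found_le := find_le_one h1.le (n + 1)
  rcases le_or_gt (y + 1) (rate p * n) with large | small
  · have dev_eq_one : dev y (rate p) n = 1 := min_eq_right (by linarith)
    rw [dev_eq_one]
    exact (mul_nonpos_of_nonneg_of_nonpos found (sub_nonpos.2 (dev_le_one _ _ _))).trans
      (mul_nonneg (sub_nonneg.2 found_le) (by positivity))
  · calc find p (n + 1) * (dev y (rate p) (n + 1) - dev y (rate p) n)
        ≤ 1 * rate p := by
          refine mul_le_mul found_le ?_ (sub_nonneg.2 (dev_le_dev_succ rate_pos.le n)) zero_le_one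
          linarith [dev_succ_le (y := y) rate_pos.le n]
      _ ≤ rate p * Real.exp (-(rate p * (n + 1 : ℕ)) + (y + 2)) := by
          rw [one_mul]
          refine le_mul_of_one_le_right rate_pos.le (Real.one_le_exp ?_)
          push_cast
          linarith [rate_le_one h2]
      _ = (1 - find p (n + 1)) * (rate p * Real.exp (y + 2)) := by
          rw [find_eq_exp h1, sub_sub_cancel, Real.exp_add]
          ring

end Find

theorem exists_le_psum {b : ℕ → ℝ} {N : ℕ} (hb : ∀ n, N ≤ n → 0 ≤ b n) :
    ∃ m, ∀ n, m ≤ psum b n := by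
  refine ⟨-∑ j ∈ Finset.range N, |b j|, fun n => ?_⟩
  have neg_le : ∀ j, -(if j < N then |b j| else 0) ≤ b j := fun j => by
    split_ifs with h
    · exact neg_abs_le _
    · rw [neg_zero]
      exact hb j (not_lt.1 h)
  refine le_trans ?_ (Finset.sum_le_sum fun j (_ : j ∈ Finset.range (n + 1)) => neg_le j)
  rw [Finset.sum_neg_distrib, neg_le_neg_iff, ← Finset.sum_filter]
  refine Finset.sum_le_sum_of_subset_of_nonneg (fun j hj => ?_) fun _ _ _ => abs_nonneg _
  exact Finset.mem_range.2 (Finset.mem_filter.1 hj).2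

theorem exists_le_chainPotential_add {y θ B : ℝ} (hy : 0 < y) (hθ : 0 < θ) (hB : 0 < B) :
    ∃ m, ∀ s, m ≤ chainPotential y θ s + B * psum (fun n => (n : ℝ) ^ 2) s.2 := by
  obtain ⟨m, hm⟩ := exists_le_psum fun n => oddsDev_nonneg hθ hy (n := n)
  refine ⟨m - 1 / (4 * B), fun s => ?_⟩
  have dev_le : (s.2 : ℝ) * dev y θ s.1 ≤ s.2 :=
    mul_le_of_le_one_right s.2.cast_nonneg (dev_le_one _ _ _)
  have sq_le := mul_le_mul_of_nonneg_left
    (le_psum (b := fun n => (n : ℝ) ^ 2) (fun n => sq_nonneg _) s.2) hB.le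
  have complete_square :
      B * (s.2 : ℝ) ^ 2 - s.2 + 1 / (4 * B) = (2 * B * s.2 - 1) ^ 2 / (4 * B) := by
    field_simp
    ring
  have : 0 ≤ (2 * B * s.2 - 1) ^ 2 / (4 * B) := by positivity
  rw [chainPotential]
  linarith [hm s.1]

end Compensation

section ChainMean

variable {pE : ℝ} (hE : 0 < pE) (hE1 : pE ≤ 1)

include hE hE1 in
theorem mean_segmentEnd_chainPotential_le {pH : ℝ} (hH : 0 < pH) (hH2 : pH ≤ 1 / 2) {y : ℝ}
    (hy : 0 ≤ y) (s : Market) :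
    mean (segmentEnd pH pE s.1 s.2) (chainPotential y (rate pH)) ≤ chainPotential y (rate pH) s
      - (dev y (rate pH) s.1 - rate pH * Real.exp (y + 2) * (1 + s.2) ^ 2) := by
  have hH1 : pH ≤ 1 := by linarith
  have B_nonneg : 0 ≤ rate pH * Real.exp (y + 2) :=
    mul_nonneg (rate_pos hH (by linarith)).le (Real.exp_pos _).le
  have dev_sub_le := find_mul_dev_sub_le hH hH2 y
  set B := rate pH * Real.exp (y + 2)
  refine mean_segmentEnd_le_of_supersolution hH hH1 hE hE1
    (U := fun h e => chainPotential y (rate pH) (h, e)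
      - (dev y (rate pH) h - B * (1 + e) ^ 2)) (fun h e => ?_) s.1 s.2
  have easy : find pE e * (chainPotential y (rate pH) (h, e - 1)
        - (dev y (rate pH) h - B * (1 + (e - 1 : ℕ)) ^ 2))
      = find pE e * (chainPotential y (rate pH) (h, e) + B * (e : ℝ) ^ 2) :=
    find_mul_congr fun e0 => by
      simp only [chainPotential, Nat.cast_pred (Nat.pos_of_ne_zero e0)]
      ring
  have missed := sub_nonneg.2 (find_le_one hH1 h)
  have sq_le := mul_le_mul_of_nonneg_left (mul_le_of_le_one_left
    (mul_nonneg B_nonneg (sq_nonneg (e : ℝ))) (find_le_one hE1 e)) missed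
  have e_nonneg : (0 : ℝ) ≤ e := e.cast_nonneg
  rw [easy]
  simp only [chainPotential]
  rcases h with - | n
  · simp only [find_zero] at sq_le ⊢
    linarith [dev_zero_nonpos hy (rate pH), mul_nonneg B_nonneg e_nonneg]
  · have balance := find_mul_oddsDev hH (by linarith) y n.succ_ne_zero
    have := mul_le_mul_of_nonneg_right (dev_sub_le n) (by linarith : 0 ≤ 1 + (e : ℝ))
    have := mul_nonneg missed (mul_nonneg B_nonneg e_nonneg)
    rw [Nat.add_sub_cancel, psum_succ]
    linarith

theorem chainPotential_hard_arrival_le {y θ : ℝ} (hθ : 0 ≤ θ) (s : Market) :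
    chainPotential y θ (s.1 + 1, s.2) - chainPotential y θ s ≤ oddsDev y θ (s.1 + 1) := by
  have := mul_le_mul_of_nonneg_left (dev_le_dev_succ (y := y) hθ s.1) (s.2.cast_nonneg (α := ℝ))
  simp only [chainPotential, psum_succ]
  linarith

theorem chainPotential_easy_arrival (y θ : ℝ) (s : Market) :
    chainPotential y θ (s.1, s.2 + 1) - chainPotential y θ s = -dev y θ s.1 := by
  simp only [chainPotential, Nat.cast_succ]
  ring

/-- The dissipation rate of `chainPotential` after the arrival of an `H` agent. -/
noncomputable def chainGain (lamH lamE θ : ℝ) (s : Market) : ℝ :=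
  dev (chainRoot lamH lamE) θ (s.1 + 1) * chainDrift lamH lamE (θ * (s.1 + 1 : ℕ))

variable {lamH lamE : ℝ} (hlH : 0 < lamH) (hlE : 0 < lamE)
include hlH hlE

theorem chainGain_nonneg {θ : ℝ} (hθ : 0 < θ) (s : Market) : 0 ≤ chainGain lamH lamE θ s :=
  min_sub_one_mul_nonneg_of_root (chainDrift_strictMonoOn lamE hlH).monotoneOn
    (mul_pos hθ (Nat.cast_pos.2 s.1.succ_pos)) (chainRoot_pos hlH hlE)
    (chainDrift_chainRoot hlH hlE)

theorem arrival_balance_le {y θ : ℝ} (hy : 0 ≤ y) (hθ : 0 ≤ θ) {q c : ℝ} (hq : 0 ≤ q)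
    (hq1 : q ≤ 1) (hqc : q ≤ c * θ) (n : ℕ) :
    lamH * (1 - q) * oddsDev y θ (n + 1) - (lamE + lamH * q) * dev y θ n
      ≤ (lamH + lamE) * (θ * (1 + c * y))
        - (1 - q) * (dev y θ (n + 1) * chainDrift lamH lamE (θ * (n + 1 : ℕ))) := by
  have l_nonneg := (add_pos hlH hlE).le
  have weight_le : lamE + lamH * q ≤ lamH + lamE := by
    linarith [mul_le_mul_of_nonneg_left hq1 hlH.le]
  have shift : (lamE + lamH * q) * (dev y θ (n + 1) - dev y θ n) ≤ (lamH + lamE) * θ :=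
    mul_le_mul weight_le (by linarith [dev_succ_le (y := y) hθ n])
      (sub_nonneg.2 (dev_le_dev_succ hθ n)) l_nonneg
  have lower := mul_le_mul_of_nonneg_left (neg_le_dev hy hθ (n + 1)) (mul_nonneg hq l_nonneg)
  have small := mul_le_mul_of_nonneg_right hqc (mul_nonneg l_nonneg hy)
  have balance := congrArg ((1 - q) * ·) (mul_oddsDev lamH lamE y θ (n + 1))
  linarith

include hE hE1

theorem chain_drift_chainPotential_le {pH : ℝ} (hH : 0 < pH) (hH2 : pH ≤ 1 / 2) {d : ℕ}
    (hd : d * pH ≤ 1 / 2) (s : Market) :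
    mean (jumpProb lamH lamE (chainMatch d pH pE) s)
        (chainPotential (chainRoot lamH lamE) (rate pH))
      ≤ chainPotential (chainRoot lamH lamE) (rate pH) s
        - chainGain lamH lamE (rate pH) s / (2 * (lamH + lamE))
        + rate pH * (1 + d * chainRoot lamH lamE)
        + 2 * (rate pH * Real.exp (chainRoot lamH lamE + 2)) * (1 + (s.2 : ℝ) ^ 2) := by
  have hH1 : pH ≤ 1 := by linarith
  have θ_pos := rate_pos hH (by linarith : pH < 1)
  have y_nonneg := (chainRoot_pos hlH hlE).le
  have gain_nonneg := chainGain_nonneg hlH hlE θ_pos s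
  have drift := chain_drift_le_of_segment hH hH1 hE hE1 d hlH hlE
    (mean_segmentEnd_chainPotential_le hE hE1 hH hH2 y_nonneg s)
  rw [chainPotential_easy_arrival] at drift
  set y := chainRoot lamH lamE
  set θ := rate pH
  have found := find_nonneg hH.le hH1 d
  have found_le := find_le_mul hH1 d
  have easy_le := find_le_one hE1 d
  have found_le_rate : find pH d ≤ d * θ := by
    linarith [mul_le_mul_of_nonneg_right (le_rate (by linarith : pH < 1)) (d.cast_nonneg (α := ℝ))]
  have hard := mul_le_mul_of_nonneg_left (chainPotential_hard_arrival_le (y := y) θ_pos.le s)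
    (mul_nonneg hlH.le (by linarith : 0 ≤ 1 - find pH d))
  have balance := arrival_balance_le hlH hlE y_nonneg θ_pos.le found (by linarith) found_le_rate s.1
  rw [← chainGain.eq_1] at balance
  have starts_le : lamH * find pH d + lamE * find pE d ≤ lamH + lamE :=
    add_le_add (mul_le_of_le_one_right hlH.le (by linarith)) (mul_le_of_le_one_right hlE.le easy_le)
  have correction : (lamH * find pH d + lamE * find pE d) * (θ * Real.exp (y + 2) * (1 + s.2) ^ 2)
      ≤ (lamH + lamE) * (θ * Real.exp (y + 2) * (2 * (1 + (s.2 : ℝ) ^ 2))) := by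
    refine mul_le_mul starts_le (mul_le_mul_of_nonneg_left ?_ (by positivity)) (by positivity)
      (add_pos hlH hlE).le
    linarith [sq_nonneg (1 - (s.2 : ℝ))]
  have half := mul_le_mul_of_nonneg_right (by linarith : (1 : ℝ) / 2 ≤ 1 - find pH d) gain_nonneg
  have cancel : (lamH + lamE) * (chainGain lamH lamE θ s / (2 * (lamH + lamE)))
      = chainGain lamH lamE θ s / 2 := by field_simp
  refine le_of_mul_le_mul_left ?_ (add_pos hlH hlE)
  linarith

theorem exists_chain_mean_gain_le {d : ℕ} (hd : 1 ≤ d) : ∃ C : ℝ, 0 ≤ C ∧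
    ∀ pH : ℝ, 0 < pH → pH ≤ 1 / 2 → d * pH ≤ 1 / 2 → ∀ π,
      IsStationary (jumpProb lamH lamE (chainMatch d pH pE)) π →
        Summable (fun s => π s * chainGain lamH lamE (rate pH) s) ∧
        mean π (chainGain lamH lamE (rate pH)) ≤ C * rate pH := by
  obtain ⟨CE, CE_nonneg, easy⟩ := exists_chain_sq_snd_drift hE hE1 hd hlH hlE
  have y_pos := chainRoot_pos hlH hlE
  set y := chainRoot lamH lamE with hy
  refine ⟨2 * (lamH + lamE) * (1 + d * y + 2 * Real.exp (y + 2) * (1 + CE)), by positivity,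
    fun pH hH hH2 hdp π hπ => ?_⟩
  have hH1 : pH ≤ 1 := by linarith
  have θ_pos := rate_pos hH (by linarith : pH < 1)
  have stochastic := isStochastic_jumpProb (isStochastic_chain hH hH1 hE hE1 d) hlH hlE
  set B := 2 * (rate pH * Real.exp (y + 2)) with hB
  obtain ⟨m, hm⟩ := exists_le_chainPotential_add y_pos θ_pos (B := B) (by positivity)
  obtain ⟨summable, mean_le⟩ := hπ.mean_le_of_drift stochastic
    (f := fun s => chainPotential y (rate pH) s + B * psum (fun n => (n : ℝ) ^ 2) s.2)
    (g := fun s => (2 * (lamH + lamE))⁻¹ * chainGain lamH lamE (rate pH) s)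
    (C := rate pH * (1 + d * y) + B * (1 + CE)) hm
    (fun s => mul_nonneg (by positivity) (chainGain_nonneg hlH hlE θ_pos s)) (by positivity)
    fun s => by
      have potential := chain_drift_chainPotential_le hE hE1 hlH hlE hH hH2 hdp s
      have correction := mul_le_mul_of_nonneg_left (easy pH hH hH1 s) (by positivity : 0 ≤ B)
      rw [← hy, ← hB, div_eq_inv_mul] at potential
      rw [(stochastic s).mean_add, mean_const_mul]
      linarith
  rw [mean_const_mul, inv_mul_le_iff₀ (by positivity)] at mean_le
  refine ⟨(summable.mul_left (2 * (lamH + lamE))).congr fun s => ?_, mean_le.trans_eq ?_⟩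
  · field_simp
  · rw [hB]
    ring

end ChainMean

/-! ### The limits of the rescaled waiting times -/

section Root

variable {m : ℝ → ℝ} {I : Set ℝ} {y ε : ℝ}

theorem exists_le_abs_of_root (hm : StrictMonoOn m I) (hI : I ∈ 𝓝 y) (root : m y = 0)
    (hε : 0 < ε) : ∃ c, 0 < c ∧ ∀ x ∈ I, ε ≤ |x - y| → c ≤ |m x| := by
  obtain ⟨r, r_pos, ball_subset⟩ := Metric.mem_nhds_iff.1 hI
  obtain ⟨δ, δ_pos, δ_lt⟩ := exists_between (lt_min hε r_pos)
  have y_mem := mem_of_mem_nhds hI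
  have right_mem : y + δ ∈ I := ball_subset <| by
    rw [Metric.mem_ball, Real.dist_eq, add_sub_cancel_left, abs_of_pos δ_pos]
    exact (lt_min_iff.1 δ_lt).2
  have left_mem : y - δ ∈ I := ball_subset <| by
    rw [Metric.mem_ball, Real.dist_eq, sub_sub_cancel_left, abs_neg, abs_of_pos δ_pos]
    exact (lt_min_iff.1 δ_lt).2
  have right_pos : 0 < m (y + δ) := root ▸ hm y_mem right_mem (by linarith)
  have left_neg : m (y - δ) < 0 := root ▸ hm left_mem y_mem (by linarith)
  refine ⟨min (m (y + δ)) (-m (y - δ)), lt_min right_pos (neg_pos.2 left_neg), fun x hx far => ?_⟩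
  have δ_le : δ ≤ |x - y| := ((lt_min_iff.1 δ_lt).1.le).trans far
  rcases le_abs.1 δ_le with above | below
  · exact (min_le_left _ _).trans
      ((hm.monotoneOn right_mem hx (by linarith)).trans (le_abs_self _))
  · exact (min_le_right _ _).trans
      ((neg_le_neg (hm.monotoneOn hx left_mem (by linarith))).trans (neg_le_abs _))

theorem exists_abs_sub_le_add_mul (hm : StrictMonoOn m I) (hI : I ∈ 𝓝 y) (root : m y = 0)
    (hε : 0 < ε) : ∃ D, 0 ≤ D ∧ ∀ x ∈ I, |x - y| ≤ ε + D * ((x - y) * m x) := by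
  obtain ⟨c, c_pos, gap⟩ := exists_le_abs_of_root hm hI root hε
  refine ⟨c⁻¹, by positivity, fun x hx => ?_⟩
  have nonneg := sub_mul_nonneg_of_root hm.monotoneOn hx (mem_of_mem_nhds hI) root
  rcases le_total |x - y| ε with near | far
  · exact near.trans (le_add_of_nonneg_right (by positivity))
  · have : |x - y| ≤ c⁻¹ * ((x - y) * m x) := by
      rw [le_inv_mul_iff₀ c_pos, ← abs_of_nonneg nonneg, abs_mul, mul_comm]
      exact mul_le_mul_of_nonneg_left (gap x hx far) (abs_nonneg _)
    linarith

theorem exists_abs_sub_le_add_min_mul (hm : StrictMonoOn m I) (hI : I ∈ 𝓝 y) (root : m y = 0)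
    (hy : 0 ≤ y) (hε : 0 < ε) {K : ℝ} (hK : 0 ≤ K) : ∃ D, 0 ≤ D ∧ ∀ x ∈ I,
      |x - y| ≤ ε + (D * (min (x - y) 1 * m x) + max 0 (x - K)) := by
  obtain ⟨c, c_pos, gap⟩ := exists_le_abs_of_root hm hI root (lt_min hε one_pos)
  refine ⟨(1 + K) / c, by positivity, fun x hx => ?_⟩
  have y_mem := mem_of_mem_nhds hI
  have tail := le_max_right 0 (x - K)
  rcases le_total |x - y| (min ε 1) with near | far
  · have nonneg := min_sub_one_mul_nonneg_of_root hm.monotoneOn hx y_mem root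
    exact (near.trans (min_le_left _ _)).trans (le_add_of_nonneg_right (by positivity))
  have slope := gap x hx far
  rcases le_total (x - y) 1 with small | large
  · have nonneg := sub_mul_nonneg_of_root hm.monotoneOn hx y_mem root
    rw [min_eq_left small, ← abs_of_nonneg nonneg, abs_mul]
    have : |x - y| ≤ (1 + K) / c * (|x - y| * |m x|) := by
      rw [div_mul_eq_mul_div, le_div_iff₀ c_pos]
      calc |x - y| * c ≤ |x - y| * |m x| := mul_le_mul_of_nonneg_left slope (abs_nonneg _)
        _ ≤ (1 + K) * (|x - y| * |m x|) := le_mul_of_one_le_left (by positivity) (by linarith)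
    linarith [le_max_left 0 (x - K)]
  · have slope_nonneg : 0 ≤ m x := root ▸ hm.monotoneOn y_mem hx (by linarith)
    rw [abs_of_nonneg slope_nonneg] at slope
    rw [min_eq_right large, one_mul, abs_of_nonneg (by linarith)]
    have : 1 + K ≤ (1 + K) / c * m x := by
      rw [div_mul_eq_mul_div, le_div_iff₀ c_pos]
      exact mul_le_mul_of_nonneg_left slope (by linarith)
    linarith

end Root

section Limits

theorem tendsto_of_forall_abs_sub_le {α : Type*} {F : Filter α} {X θ : α → ℝ} {l : ℝ}
    (hθ : Tendsto θ F (𝓝 0)) (h : ∀ ε > 0, ∃ D, ∀ᶠ p in F, |X p - l| ≤ ε + D * θ p) :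
    Tendsto X F (𝓝 l) := by
  refine Metric.tendsto_nhds.2 fun ε hε => ?_
  obtain ⟨D, bound⟩ := h (ε / 2) (half_pos hε)
  have limit : Tendsto (fun p => ε / 2 + D * θ p) F (𝓝 (ε / 2)) := by
    simpa only [mul_zero, add_zero] using (hθ.const_mul D).const_add (ε / 2)
  filter_upwards [bound, limit.eventually (gt_mem_nhds (half_lt_self hε))] with p le lt
  exact le.trans_lt lt

theorem abs_mean_sub_le {S : Type*} {π x u : S → ℝ} {y ε : ℝ} (hπ0 : ∀ s, 0 ≤ π s)
    (hπ1 : HasSum π 1) (hx : Summable fun s => π s * x s) (hu : Summable fun s => π s * u s)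
    (h : ∀ s, |x s - y| ≤ ε + u s) : |mean π x - y| ≤ ε + mean π u := by
  have deviation := hx.hasSum.sub (hπ1.mul_right y)
  have bound := (hπ1.mul_right ε).add hu.hasSum
  have abs_le_bound : ∀ s, |π s * x s - π s * y| ≤ π s * ε + π s * u s := fun s => by
    rw [← mul_sub, ← mul_add, abs_mul, abs_of_nonneg (hπ0 s)]
    exact mul_le_mul_of_nonneg_left (h s) (hπ0 s)
  rw [one_mul] at deviation bound
  exact abs_le.2 ⟨hasSum_le (fun s => (abs_le.1 (abs_le_bound s)).1) bound.neg deviation,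
    hasSum_le (fun s => (abs_le.1 (abs_le_bound s)).2) deviation bound⟩

theorem tendsto_rate_div (a : ℝ) : Tendsto (fun p => rate (a * p) / p) (𝓝[>] 0) (𝓝 a) := by
  have linear : HasDerivAt (fun p : ℝ => 1 - a * p) (-a) 0 := by
    simpa only [mul_one] using ((hasDerivAt_id' (0 : ℝ)).const_mul a).const_sub 1
  have slope : HasDerivAt (fun p => rate (a * p)) a 0 :=
    (linear.log (by norm_num)).neg.congr_deriv (by norm_num)
  refine slope.tendsto_slope_zero_right.congr fun p => ?_
  rw [zero_add, mul_zero, rate, rate, sub_zero, Real.log_one, neg_zero, sub_zero, smul_eq_mul,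
    inv_mul_eq_div]

theorem tendsto_rate (a : ℝ) : Tendsto (fun p => rate (a * p)) (𝓝[>] 0) (𝓝 0) := by
  have product := (tendsto_rate_div a).mul (tendsto_nhdsWithin_of_tendsto_nhds tendsto_id)
  rw [mul_zero] at product
  refine product.congr' ?_
  filter_upwards [self_mem_nhdsWithin] with p hp
  exact div_mul_cancel₀ _ (ne_of_gt hp)

variable {lamH lamE pE : ℝ}

theorem IsPolicy.mul_avgWaitH_eq {P : Kind → Market → Market → ℝ} (hP : IsPolicy P)
    (hlH : 0 < lamH) (hlE : 0 < lamE) {p θ : ℝ} (hp : 0 < p) (hθ : θ ≠ 0)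
    (hπ : IsStationary (jumpProb lamH lamE P) (steadyState (rateMatrix lamH lamE P)))
    (summable : Summable fun s : Market => steadyState (rateMatrix lamH lamE P) s * s.1) :
    ENNReal.ofReal p * avgWaitH lamH lamE P = ENNReal.ofReal
      (mean (steadyState (rateMatrix lamH lamE P)) (fun s => θ * s.1) / (θ / p) / lamH) := by
  rw [hP.avgWaitH_eq hlH hlE hπ summable, ← ENNReal.ofReal_mul hp.le, mean_const_mul]
  field_simp

theorem tendsto_mul_avgWaitH {P : ℝ → Kind → Market → Market → ℝ} {a y : ℝ} (hlH : 0 < lamH)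
    (hlE : 0 < lamE) (ha : 0 < a) (hP : ∀ p, 0 < p → p ≤ 1 → IsPolicy (P p))
    (exists_steady : ∀ p, 0 < p → p ≤ 1 → ∃ π, IsSteadyState (rateMatrix lamH lamE (P p)) π)
    (summable : ∀ p, 0 < p → p ≤ 1 → ∀ π, IsStationary (jumpProb lamH lamE (P p)) π →
      Summable fun s : Market => π s * s.1)
    (bound : ∀ ε > 0, ∃ D, ∀ᶠ p in 𝓝[>] (0 : ℝ), ∀ π,
      IsStationary (jumpProb lamH lamE (P p)) π →
        |mean π (fun s : Market => rate (a * p) * s.1) - y| ≤ ε + D * rate (a * p)) :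
    Tendsto (fun p => ENNReal.ofReal p * avgWaitH lamH lamE (P p)) (𝓝[>] 0)
      (𝓝 (ENNReal.ofReal (y / a / lamH))) := by
  have stationary : ∀ p, 0 < p → p ≤ 1 → IsStationary (jumpProb lamH lamE (P p))
      (steadyState (rateMatrix lamH lamE (P p))) := fun p h0 h1 =>
    (isSteadyState_iff (hP p h0 h1).stochastic hlH hlE).1
      (Classical.epsilon_spec (exists_steady p h0 h1))
  have unit : ∀ᶠ p in 𝓝[>] (0 : ℝ), p ∈ Set.Ioc 0 1 := Ioc_mem_nhdsGT zero_lt_one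
  have number := tendsto_of_forall_abs_sub_le (tendsto_rate a) fun ε hε => by
    obtain ⟨D, eventually_le⟩ := bound ε hε
    refine ⟨D, ?_⟩
    filter_upwards [eventually_le, unit] with p le hp
    exact le _ (stationary p hp.1 hp.2)
  refine (ENNReal.tendsto_ofReal
    ((number.div (tendsto_rate_div a) ha.ne').div_const lamH)).congr' ?_
  filter_upwards [unit, (tendsto_rate_div a).eventually (lt_mem_nhds ha)] with p hp rate_div_pos
  have := stationary p hp.1 hp.2
  exact ((hP p hp.1 hp.2).mul_avgWaitH_eq hlH hlE hp.1
    (fun rate_zero => by rw [rate_zero, zero_div] at rate_div_pos; exact rate_div_pos.false) this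
    (summable p hp.1 hp.2 _ this)).symm

theorem bilateral_limit (hlH : 0 < lamH) (hlt : lamH < lamE) (hE : 0 < pE) (hE1 : pE ≤ 1) :
    Tendsto (fun pH => ENNReal.ofReal pH * avgWaitH lamH lamE (bilateralMatchH pH pE)) (𝓝[>] 0)
      (𝓝 (ENNReal.ofReal (rate (lamH / lamE) / pE / lamH))) := by
  have hlE := hlH.trans hlt
  refine tendsto_mul_avgWaitH hlH hlE hE (fun p h0 h1 => isPolicy_bilateral h0 h1 hE hE1)
    (fun p h0 h1 => (bilateral_existsUnique_isSteadyState h0 h1 hE hE1 hlH hlE).exists)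
    (fun p h0 h1 π hπ => bilateral_summable_mul_fst h0 h1 hE hE1 hlH hlE hπ) fun ε hε => ?_
  obtain ⟨C, -, dissipation⟩ := exists_bilateral_mean_drift_le hlH hlt hE hE1
  obtain ⟨D, hD, deviation⟩ := exists_abs_sub_le_add_mul
    ((bilateralDrift_strictMono hlE).strictMonoOn Set.univ) univ_mem
    (bilateralDrift_rate hlH hlt) hε
  refine ⟨D * C, ?_⟩
  filter_upwards [Ioo_mem_nhdsGT zero_lt_one] with p hp π hπ
  obtain ⟨summable, mean_le⟩ := dissipation p hp.1 hp.2 π hπ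
  have number := (bilateral_summable_mul_fst hp.1 hp.2.le hE hE1 hlH hlE hπ).mul_left
    (rate (pE * p))
  refine (abs_mean_sub_le hπ.nonneg hπ.hasSum_one (number.congr fun s => mul_left_comm _ _ _)
    ((summable.mul_left D).congr fun s => mul_left_comm _ _ _)
    fun s => deviation _ (Set.mem_univ _)).trans (add_le_add_right ?_ ε)
  rw [mean_const_mul, mul_assoc]
  exact mul_le_mul_of_nonneg_left mean_le hD

theorem abs_chain_mean_sub_le {θ ε D K : ℝ} {π : Market → ℝ} (hπ0 : ∀ s, 0 ≤ π s)
    (hπ1 : HasSum π 1) (hθ : 0 < θ) (hθ1 : θ ≤ 1)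
    (deviation : ∀ x ∈ Set.Ioi (0 : ℝ), |x - chainRoot lamH lamE| ≤ ε
      + (D * (min (x - chainRoot lamH lamE) 1 * chainDrift lamH lamE x) + max 0 (x - (K + 1))))
    (number : Summable fun s : Market => π s * s.1)
    (gain : Summable fun s => π s * chainGain lamH lamE θ s)
    (tail : Summable fun s : Market => π s * max 0 (θ * s.1 - K)) :
    |mean π (fun s : Market => θ * s.1) - chainRoot lamH lamE|
      ≤ ε + (D * mean π (chainGain lamH lamE θ) + mean π (fun s => max 0 (θ * s.1 - K))) + θ := by
  have gain_mul : Summable fun s => π s * (D * chainGain lamH lamE θ s) :=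
    (gain.mul_left D).congr fun s => mul_left_comm _ _ _
  have scaled : Summable fun s : Market => π s * (θ * s.1) :=
    (number.mul_left θ).congr fun s => mul_left_comm _ _ _
  have shifted := scaled.hasSum.add (hπ1.mul_right θ)
  have shifted_eq : (fun s : Market => π s * (θ * s.1) + π s * θ)
      = fun s => π s * (θ * (s.1 + 1 : ℕ)) := by
    funext s
    push_cast
    ring
  rw [shifted_eq, one_mul] at shifted
  have close := abs_mean_sub_le hπ0 hπ1 shifted.summable
    ((gain_mul.add tail).congr fun s => (mul_add _ _ _).symm) (ε := ε) fun s =>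
      (deviation _ (mul_pos hθ (Nat.cast_pos.2 s.1.succ_pos))).trans <|
        add_le_add_right (add_le_add_right (max_le_max le_rfl (by push_cast; linarith)) _) ε
  have mean_shifted : mean π (fun s : Market => θ * (s.1 + 1 : ℕ))
      = mean π (fun s : Market => θ * s.1) + θ := shifted.tsum_eq
  have mean_split : mean π (fun s => D * chainGain lamH lamE θ s + max 0 (θ * s.1 - K))
      = D * mean π (chainGain lamH lamE θ) + mean π fun s => max 0 (θ * s.1 - K) := by
    rw [← mean_const_mul]
    simpa only [mean, mul_add] using gain_mul.tsum_add tail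
  rw [mean_shifted, mean_split] at close
  rw [abs_le] at close ⊢
  constructor <;> linarith [close.1, close.2]

theorem chain_limit (hlH : 0 < lamH) (hlE : 0 < lamE) (hE : 0 < pE) (hE1 : pE ≤ 1) {d : ℕ}
    (hd : 1 ≤ d) :
    Tendsto (fun pH => ENNReal.ofReal pH * avgWaitH lamH lamE (chainMatch d pH pE)) (𝓝[>] 0)
      (𝓝 (ENNReal.ofReal (chainRoot lamH lamE / lamH))) := by
  rw [← div_one (chainRoot lamH lamE)]
  refine tendsto_mul_avgWaitH hlH hlE one_pos (fun p h0 h1 => isPolicy_chain h0 h1 hE hE1 hd)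
    (fun p h0 h1 => (chain_existsUnique_isSteadyState hE hE1 hd hlH hlE h0 h1).exists)
    (fun p h0 h1 π hπ => chain_summable_mul_fst hE hE1 hd hlH hlE h0 h1 hπ) fun ε hε => ?_
  obtain ⟨C, -, dissipation⟩ := exists_chain_mean_gain_le hE hE1 hlH hlE hd
  obtain ⟨K, C', hK, -, tail_le⟩ := exists_chain_tail_mean_le hE hE1 hd hlH hlE
  have y_pos := chainRoot_pos hlH hlE
  have d_pos : 0 < (d : ℝ) := Nat.cast_pos.2 hd
  obtain ⟨D, hD, deviation⟩ := exists_abs_sub_le_add_min_mul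
    (chainDrift_strictMonoOn lamE hlH) (Ioi_mem_nhds y_pos) (chainDrift_chainRoot hlH hlE)
    y_pos.le hε (add_nonneg hK zero_le_one)
  refine ⟨D * C + C' + 1, ?_⟩
  filter_upwards [Ioc_mem_nhdsGT one_half_pos,
    Ioc_mem_nhdsGT (show 0 < 1 / 2 / (d : ℝ) by positivity)] with p hp hdp π hπ
  have p_lt : p < 1 := hp.2.trans_lt one_half_lt_one
  obtain ⟨gain_summable, gain_le⟩ := dissipation p hp.1 hp.2 ((le_div_iff₀' d_pos).1 hdp.2) π hπ
  obtain ⟨tail_summable, tail_mean_le⟩ := tail_le p hp.1 p_lt π hπ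
  have number := chain_summable_mul_fst hE hE1 hd hlH hlE hp.1 p_lt.le hπ
  have := abs_chain_mean_sub_le hπ.nonneg hπ.hasSum_one (rate_pos hp.1 p_lt) (rate_le_one hp.2)
    deviation number gain_summable tail_summable
  rw [one_mul]
  linarith [mul_le_mul_of_nonneg_left gain_le hD]

theorem chainRoot_lt_rate {lamH lamE : ℝ} (hlH : 0 < lamH) (hlt : lamH < lamE) :
    chainRoot lamH lamE < rate (lamH / lamE) := by
  have hlE := hlH.trans hlt
  have ratio_pos := div_pos hlH hlE
  have ratio_lt := (div_lt_one hlE).2 hlt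
  rw [chainRoot, rate, ← Real.log_inv]
  refine Real.log_lt_log (by linarith) ((lt_inv_comm₀ (by linarith) (by linarith)).2 ?_)
  rw [← one_div, lt_div_iff₀ (by linarith)]
  nlinarith

end Limits

end DynMatch

theorem mainTheorem6 (lamH lamE pE : ℝ) (d : ℕ) (hH : 0 < lamH) (hHE : lamH < lamE)
    (hpE : 0 < pE) (hpE1 : pE ≤ 1) (hd : 1 ≤ d) :
    (∀ pH : ℝ, 0 < pH → pH ≤ 1 →
      (∃! π, DynMatch.IsSteadyState
        (DynMatch.rateMatrix lamH lamE (DynMatch.chainMatch d pH pE)) π) ∧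
      (∃! π, DynMatch.IsSteadyState
        (DynMatch.rateMatrix lamH lamE (DynMatch.bilateralMatchH pH pE)) π)) ∧
    ∃ wC wB : ℝ, 0 < wC ∧ wC < wB ∧
      Filter.Tendsto
        (fun pH : ℝ => ENNReal.ofReal pH *
          DynMatch.avgWaitH lamH lamE (DynMatch.chainMatch d pH pE))
        (nhdsWithin 0 (Set.Ioi 0)) (nhds (ENNReal.ofReal wC)) ∧
      Filter.Tendsto
        (fun pH : ℝ => ENNReal.ofReal pH *
          DynMatch.avgWaitH lamH lamE (DynMatch.bilateralMatchH pH pE))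
        (nhdsWithin 0 (Set.Ioi 0)) (nhds (ENNReal.ofReal wB)) := by
  have hE := hH.trans hHE
  have ratio_pos := div_pos hH hE
  have ratio_lt_one := (div_lt_one hE).2 hHE
  refine ⟨fun pH h0 h1 => ⟨DynMatch.chain_existsUnique_isSteadyState hpE hpE1 hd hH hE h0 h1,
      DynMatch.bilateral_existsUnique_isSteadyState h0 h1 hpE hpE1 hH hE⟩,
    DynMatch.chainRoot lamH lamE / lamH, DynMatch.rate (lamH / lamE) / pE / lamH,
    div_pos (DynMatch.chainRoot_pos hH hE) hH, div_lt_div_of_pos_right ?_ hH,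
    DynMatch.chain_limit hH hE hpE hpE1 hd, DynMatch.bilateral_limit hH hHE hpE hpE1⟩
  calc DynMatch.chainRoot lamH lamE < DynMatch.rate (lamH / lamE) :=
        DynMatch.chainRoot_lt_rate hH hHE
    _ ≤ DynMatch.rate (lamH / lamE) / pE :=
        le_div_self (DynMatch.rate_pos ratio_pos ratio_lt_one).le hpE hpE1
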